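/- **Setting.** Let $(B,g_B)$ be a smooth Riemannian surface (the regular locus of the base) with Riemannian measure $\mu_B$, and let $B_0\subset B$ be open with compact closure in $B$. For each $t\in(0,t_0]$ let $(X_t,g(t))$ be a smooth Riemannian $4$-manifold with Riemannian measure $\mu_t$, and let $\Pi_t:X_t\to B$ be a smooth surjective submersion with fibers $F_b=\Pi_t^{-1}(b)$. Put $X_{t,0}=\Pi_t^{-1}(B_0)$. Over $B_0$ let a horizontal/vertical splitting of $TX_t$ be given (the vertical space being $\ker d\Pi_t$), together with flat metrics $g_{F,t}$ along the fibers for which each $F_b$, $b\in B_0$, is a flat $2$-torus; write $g_t^{\Pi}=g_B\oplus g_{F,t}$ for the corresponding product reference metric, $\vartheta_{t,b}$ for the Haar probability measure of $F_b$, and $\lambda_1(F_b,g_{F,t})$ for the first nonzero eigenvalue of the nonnegative Laplacian of $F_b$. Assume that there are $\varepsilon_t\to0$ and $s(t)>0$ with $s(t)\to 0$ as $t\downarrow0$, and constants $c>0$ and $K$, such that: 1. (semi-flat control) $\|g(t)-g_t^{\Pi}\|_{C^0(X_{t,0},\,g_t^{\Pi})}\le\varepsilon_t$ for all $t$; 2.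 (vertical gap) $\lambda_1(F_b,g_{F,t})\ge c\,s(t)^{-2}$ for all $t$ and all $b\in B_0$; 3. (normalized disintegration) there are measurable functions $A_t>0$ on $B_0$ and $\rho_t>0$ on $X_{t,0}$ with $\int_{F_b}\rho_t\,d\vartheta_{t,b}=1$ for all $b\in B_0$, $$\int_{X_{t,0}}f\,d\mu_t=\int_{B_0}A_t(b)\Big(\int_{F_b}f\,\rho_t\,d\vartheta_{t,b}\Big)d\mu_B(b)$$ for all measurable $f\ge0$ (the inner integral being measurable in $b$), and $\|\rho_t-1\|_{L^\infty(X_{t,0})}\le K\varepsilon_t$. Let $L^2_B=L^2(B_0,\mu_B)$ and $L^2_t=L^2(X_{t,0},\mu_t)$, and define $I_t:L^2_B\to L^2_t$ and $P_t:L^2_t\to L^2_B$ by $$(I_tv)(x)=A_t(\Pi_t(x))^{-1/2}\,v(\Pi_t(x)),\qquad (P_tu)(b)=A_t(b)^{1/2}\int_{F_b}u\,\rho_t\,d\vartheta_{t,b}.$$ Let $H_t\ge0$ be the Dirichlet Laplacian of $g(t)$ on $X_{t,0}$, i.e. the selfadjoint operator on $L^2_t$ of the closure of the form $u\mapsto\int_{X_{t,0}}|\nabla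 u|_{g(t)}^2\,d\mu_t$ on $C_c^\infty(X_{t,0})$. Let $T_t(\tau)=e^{-\tau H_t}$ and let $S_t(\tau)=P_tT_t(\tau)I_t$ be the compressed heat operator on $L^2_B$. **Proposition (asymptotic semigroup property).** There are $C>0$ and $t_1>0$ such that for all $t\in(0,t_0]$ with $t\le t_1$ and all $\tau,\sigma>0$ $$\|S_t(\tau)S_t(\sigma)-S_t(\tau+\sigma)\|_{L^2_B\to L^2_B}\le C\,\frac{s(t)}{\sqrt\sigma}.$$ In particular, for each fixed $\tau>0$, $\|S_t(\tau)^2-S_t(2\tau)\|_{L^2_B\to L^2_B}\to0$ as $t\downarrow0$. -/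

import Mathlib

open Manifold Bundle MeasureTheory Set Filter Topology
open scoped ContDiff ENNReal

noncomputable section

namespace SemiFlat

set_option linter.unusedSectionVars false

/-- Euclidean `n`-space. -/
abbrev EucSpace (n : ℕ) : Type := EuclideanSpace ℝ (Fin n)

/-- A smooth Riemannian metric on the `n`-manifold `M`. -/
abbrev SmoothMetric (n : ℕ) (M : Type*) [TopologicalSpace M] [ChartedSpace (EucSpace n) M]
    [IsManifold (𝓡 n) ∞ M] :=
  ContMDiffRiemannianMetric (𝓡 n) ∞ (EucSpace n) (fun x : M => TangentSpace (𝓡 n) x)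

section RiemannianMeasure

variable {n : ℕ} {M : Type*} [TopologicalSpace M] [ChartedSpace (EucSpace n) M]
  [IsManifold (𝓡 n) ∞ M]

/-- The `i`-th coordinate vector field of the chart at `x`, at the point with coordinates `y`. -/
def chartFrame (x : M) (y : EucSpace n) (i : Fin n) :
    TangentSpace (𝓡 n) ((chartAt (EucSpace n) x).symm y) :=
  mfderiv (𝓡 n) (𝓡 n) (chartAt (EucSpace n) x).symm y
    (EuclideanSpace.single i (1 : ℝ) : EucSpace n)

/-- The matrix `g_ij` of the metric in the chart at `x`, at the point with coordinates `y`. -/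
def chartGram (g : SmoothMetric n M) (x : M) (y : EucSpace n) : Matrix (Fin n) (Fin n) ℝ :=
  Matrix.of fun i j => g.inner ((chartAt (EucSpace n) x).symm y) (chartFrame x y i) (chartFrame x y j)

lemma contMDiffOn_chartFrame (x : M) (i : Fin n) :
    ContMDiffOn (𝓡 n) (𝓡 n).tangent ∞
      (fun y => TotalSpace.mk' (EucSpace n) (E := fun p : M => TangentSpace (𝓡 n) p)
        ((chartAt (EucSpace n) x).symm y) (chartFrame x y i))
      (chartAt (EucSpace n) x).target := by
  have : IsManifold (𝓡 n) 1 M := .of_le (n := ∞) (by simp)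
  have h1 : ContMDiffOn (𝓡 n) (𝓡 n) ∞ (chartAt (EucSpace n) x).symm
      (chartAt (EucSpace n) x).target := contMDiffOn_chart_symm
  have ho := (chartAt (EucSpace n) x).open_target
  have h2 := h1.contMDiffOn_tangentMapWithin (m := ∞) (by simp) ho.uniqueMDiffOn
  have h3 : ContMDiff (𝓡 n) (𝓡 n).tangent ∞
      (fun y : EucSpace n => TotalSpace.mk' (EucSpace n)
        (E := fun p : EucSpace n => TangentSpace (𝓡 n) p) y
        (EuclideanSpace.single i (1 : ℝ) : EucSpace n)) := by
    rw [contMDiff_vectorSpace_iff_contDiff (V := fun _ => EuclideanSpace.single i (1 : ℝ))]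
    exact contDiff_const
  have h4 := h2.comp (s := (chartAt (EucSpace n) x).target) h3.contMDiffOn (fun y hy => hy)
  refine h4.congr fun y hy => ?_
  simp only [Function.comp, tangentMapWithin, chartFrame]
  rw [mfderivWithin_of_isOpen ho hy]

lemma continuousOn_chartGram_apply (g : SmoothMetric n M) (x : M) (i j : Fin n) :
    ContinuousOn (fun y => chartGram g x y i j) (chartAt (EucSpace n) x).target := by
  have h := contMDiffOn_chartFrame (n := n) x
  have hg : ContMDiffOn (𝓡 n) ((𝓡 n).prod 𝓘(ℝ, EucSpace n →L[ℝ] EucSpace n →L[ℝ] ℝ)) ∞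
      (fun y => TotalSpace.mk' (EucSpace n →L[ℝ] EucSpace n →L[ℝ] ℝ)
        (E := fun p : M => TangentSpace (𝓡 n) p →L[ℝ] TangentSpace (𝓡 n) p →L[ℝ] ℝ)
        ((chartAt (EucSpace n) x).symm y) (g.inner ((chartAt (EucSpace n) x).symm y)))
      (chartAt (EucSpace n) x).target :=
    g.contMDiff.comp_contMDiffOn contMDiffOn_chart_symm
  have h5 := ContMDiffOn.clm_bundle_apply₂ (F₁ := EucSpace n) (F₂ := EucSpace n)
    (F₃ := ℝ) (E₃ := Bundle.Trivial M ℝ) hg (h i) (h j)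
  have h6 : ContMDiffOn (𝓡 n) 𝓘(ℝ, ℝ) ∞ (fun y => chartGram g x y i j)
      (chartAt (EucSpace n) x).target := by
    intro y hy
    have := h5 y hy
    rw [contMDiffWithinAt_totalSpace] at this
    exact this.2
  exact h6.continuousOn


lemma inner_congr_point (g : SmoothMetric n M) {p q : M} (h : p = q) (a b : EucSpace n) :
    g.inner p a b = g.inner q a b := by
  subst h; rfl

lemma bilin_sum_sum {n : ℕ} (b : EucSpace n →L[ℝ] EucSpace n →L[ℝ] ℝ) (a c : Fin n → ℝ)
    (f : Fin n → EucSpace n) :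
    b (∑ k, a k • f k) (∑ l, c l • f l) = ∑ k, a k * ∑ l, b (f k) (f l) * c l := by
  simp only [map_sum, map_smul, sum_apply, smul_apply, smul_eq_mul, Finset.mul_sum]
  rw [Finset.sum_comm]
  refine Finset.sum_congr rfl fun k _ => Finset.sum_congr rfl fun l _ => by ring

/-- The coordinate change between the charts at `x` and at `x'`. -/
lemma chartTransition_hasFDerivAt (x x' : M) {y : EucSpace n}
    (hy : y ∈ (chartAt (EucSpace n) x).target)
    (hy' : (chartAt (EucSpace n) x).symm y ∈ (chartAt (EucSpace n) x').source) :
    HasFDerivAt (chartAt (EucSpace n) x' ∘ (chartAt (EucSpace n) x).symm)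
      (fderiv ℝ (chartAt (EucSpace n) x' ∘ (chartAt (EucSpace n) x).symm) y) y := by
  have h1 : ContMDiffAt (𝓡 n) (𝓡 n) ∞ (chartAt (EucSpace n) x).symm y :=
    contMDiffOn_chart_symm.contMDiffAt ((chartAt (EucSpace n) x).open_target.mem_nhds hy)
  have h2 : ContMDiffAt (𝓡 n) (𝓡 n) ∞ (chartAt (EucSpace n) x')
      ((chartAt (EucSpace n) x).symm y) :=
    contMDiffOn_chart.contMDiffAt ((chartAt (EucSpace n) x').open_source.mem_nhds hy')
  exact ((h2.comp y h1).contDiffAt.differentiableAt (by simp)).hasFDerivAt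

lemma mfderiv_chart_symm_transition (x x' : M) {y : EucSpace n}
    (hy : y ∈ (chartAt (EucSpace n) x).target)
    (hy' : (chartAt (EucSpace n) x).symm y ∈ (chartAt (EucSpace n) x').source) (v : EucSpace n) :
    (mfderiv (𝓡 n) (𝓡 n) (chartAt (EucSpace n) x).symm y v : EucSpace n) =
      mfderiv (𝓡 n) (𝓡 n) (chartAt (EucSpace n) x').symm
        ((chartAt (EucSpace n) x' ∘ (chartAt (EucSpace n) x).symm) y)
        (fderiv ℝ (chartAt (EucSpace n) x' ∘ (chartAt (EucSpace n) x).symm) y v) := by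
  set e := chartAt (EucSpace n) x
  set e' := chartAt (EucSpace n) x'
  have h1 : ContMDiffAt (𝓡 n) (𝓡 n) ∞ e.symm y :=
    contMDiffOn_chart_symm.contMDiffAt (e.open_target.mem_nhds hy)
  have h2 : ContMDiffAt (𝓡 n) (𝓡 n) ∞ e' (e.symm y) :=
    contMDiffOn_chart.contMDiffAt (e'.open_source.mem_nhds hy')
  have h3 : ContMDiffAt (𝓡 n) (𝓡 n) ∞ e'.symm ((e' ∘ e.symm) y) :=
    contMDiffOn_chart_symm.contMDiffAt (e'.open_target.mem_nhds (e'.map_source hy'))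
  have h4 : (e'.symm ∘ (e' ∘ e.symm)) =ᶠ[𝓝 y] e.symm := by
    have : e.symm ⁻¹' e'.source ∈ 𝓝 y :=
      h1.continuousAt.preimage_mem_nhds (e'.open_source.mem_nhds hy')
    filter_upwards [this] with z hz
    exact e'.left_inv hz
  have h5 := h4.mfderiv_eq (I := 𝓡 n) (I' := 𝓡 n)
  have h6 := mfderiv_comp (I := 𝓡 n) (I' := 𝓡 n) (I'' := 𝓡 n) y
    (h3.mdifferentiableAt (by simp)) ((h2.comp y h1).mdifferentiableAt (by simp))
  rw [← mfderiv_eq_fderiv]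
  have h7 := h6.symm.trans h5
  exact (DFunLike.congr_fun h7 v).symm

lemma chartGram_transition (g : SmoothMetric n M) (x x' : M) {y : EucSpace n}
    (hy : y ∈ (chartAt (EucSpace n) x).target)
    (hy' : (chartAt (EucSpace n) x).symm y ∈ (chartAt (EucSpace n) x').source) :
    chartGram g x y =
      (LinearMap.toMatrix (EuclideanSpace.basisFun (Fin n) ℝ).toBasis
        (EuclideanSpace.basisFun (Fin n) ℝ).toBasis
        (fderiv ℝ (chartAt (EucSpace n) x' ∘ (chartAt (EucSpace n) x).symm) y :
          EucSpace n →ₗ[ℝ] EucSpace n)).transpose *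
      chartGram g x' ((chartAt (EucSpace n) x' ∘ (chartAt (EucSpace n) x).symm) y) *
      (LinearMap.toMatrix (EuclideanSpace.basisFun (Fin n) ℝ).toBasis
        (EuclideanSpace.basisFun (Fin n) ℝ).toBasis
        (fderiv ℝ (chartAt (EucSpace n) x' ∘ (chartAt (EucSpace n) x).symm) y :
          EucSpace n →ₗ[ℝ] EucSpace n)) := by
  set φ := chartAt (EucSpace n) x' ∘ (chartAt (EucSpace n) x).symm
  have hp : (chartAt (EucSpace n) x).symm y = (chartAt (EucSpace n) x').symm (φ y) :=
    ((chartAt (EucSpace n) x').left_inv hy').symm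
  have hexp : ∀ i : Fin n, (chartFrame x y i : EucSpace n) =
      ∑ k, LinearMap.toMatrix (EuclideanSpace.basisFun (Fin n) ℝ).toBasis
        (EuclideanSpace.basisFun (Fin n) ℝ).toBasis (fderiv ℝ φ y : EucSpace n →ₗ[ℝ] EucSpace n) k i •
        (chartFrame x' (φ y) k : EucSpace n) := by
    intro i
    have h1 := mfderiv_chart_symm_transition x x' hy hy' (EuclideanSpace.single i (1 : ℝ))
    have h2 : fderiv ℝ φ y (EuclideanSpace.single i (1 : ℝ)) =
        ∑ k, LinearMap.toMatrix (EuclideanSpace.basisFun (Fin n) ℝ).toBasis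
        (EuclideanSpace.basisFun (Fin n) ℝ).toBasis (fderiv ℝ φ y : EucSpace n →ₗ[ℝ] EucSpace n) k i •
        (EuclideanSpace.single k (1 : ℝ) : EucSpace n) := by
      ext m
      simp [LinearMap.toMatrix_apply, Pi.single_apply]
    refine h1.trans ?_
    rw [h2]
    exact (map_sum _ _ _).trans (Finset.sum_congr rfl fun k _ => map_smul _ _ _)
  ext i j
  have h3 : chartGram g x y i j = g.inner ((chartAt (EucSpace n) x').symm (φ y))
      (chartFrame x y i : EucSpace n) (chartFrame x y j : EucSpace n) :=
    inner_congr_point g hp _ _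
  rw [h3, hexp i, hexp j, Matrix.mul_assoc]
  simp only [Matrix.mul_apply, Matrix.transpose_apply]
  exact bilin_sum_sum (g.inner ((chartAt (EucSpace n) x').symm (φ y))) _ _ _

/-- The Gram matrix of a metric in a chart is positive definite. -/
lemma chartGram_posDef (g : SmoothMetric n M) (x : M) {y : EucSpace n}
    (hy : y ∈ (chartAt (EucSpace n) x).target) : (chartGram g x y).PosDef := by
  have hinj : ∀ v : EucSpace n, (mfderiv (𝓡 n) (𝓡 n) (chartAt (EucSpace n) x).symm y v : EucSpace n) = 0 →
      v = 0 := by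
    intro v hv
    set e := chartAt (EucSpace n) x
    have h1 : ContMDiffAt (𝓡 n) (𝓡 n) ∞ e.symm y :=
      contMDiffOn_chart_symm.contMDiffAt (e.open_target.mem_nhds hy)
    have h2 : ContMDiffAt (𝓡 n) (𝓡 n) ∞ e (e.symm y) :=
      contMDiffOn_chart.contMDiffAt (e.open_source.mem_nhds (e.map_target hy))
    have h4 : (e ∘ e.symm) =ᶠ[𝓝 y] id := by
      filter_upwards [e.open_target.mem_nhds hy] with z hz
      exact e.right_inv hz
    have h5 := h4.mfderiv_eq (I := 𝓡 n) (I' := 𝓡 n)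
    have h6 := mfderiv_comp (I := 𝓡 n) (I' := 𝓡 n) (I'' := 𝓡 n) y
      (h2.mdifferentiableAt (by simp)) (h1.mdifferentiableAt (by simp))
    have h7 := DFunLike.congr_fun (h6.symm.trans h5) v
    rw [mfderiv_id] at h7
    refine Eq.trans (Eq.symm h7) ?_
    exact (congrArg (mfderiv (𝓡 n) (𝓡 n) e (e.symm y)) hv).trans (map_zero _)
  refine Matrix.PosDef.of_dotProduct_mulVec_pos ?_ fun v hv => ?_
  · ext i j
    simp only [Matrix.conjTranspose_apply, star_trivial]
    exact g.symm _ _ _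
  · have hw : (mfderiv (𝓡 n) (𝓡 n) (chartAt (EucSpace n) x).symm y (WithLp.toLp 2 v : EucSpace n) :
        EucSpace n) = ∑ i, v i • (chartFrame x y i : EucSpace n) := by
      have : (WithLp.toLp 2 v : EucSpace n) = ∑ i, v i • (EuclideanSpace.single i (1 : ℝ) : EucSpace n) := by
        ext m
        simp [Pi.single_apply]
      rw [this]
      exact (map_sum _ _ _).trans (Finset.sum_congr rfl fun k _ => map_smul _ _ _)
    have hne : (mfderiv (𝓡 n) (𝓡 n) (chartAt (EucSpace n) x).symm y (WithLp.toLp 2 v : EucSpace n) :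
        EucSpace n) ≠ 0 := fun h0 => hv (by simpa using hinj _ h0)
    have hpos := g.pos ((chartAt (EucSpace n) x).symm y) _ hne
    refine hpos.trans_eq ?_
    rw [hw]
    exact (bilin_sum_sum (g.inner ((chartAt (EucSpace n) x).symm y)) _ _ _).trans
      (by simp only [dotProduct, Matrix.mulVec, star_trivial]; rfl)

lemma sqrt_det_chartGram_transition (g : SmoothMetric n M) (x x' : M) {y : EucSpace n}
    (hy : y ∈ (chartAt (EucSpace n) x).target)
    (hy' : (chartAt (EucSpace n) x).symm y ∈ (chartAt (EucSpace n) x').source) :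
    √(chartGram g x y).det =
      |(fderiv ℝ (chartAt (EucSpace n) x' ∘ (chartAt (EucSpace n) x).symm) y).det| *
      √(chartGram g x' ((chartAt (EucSpace n) x' ∘ (chartAt (EucSpace n) x).symm) y)).det := by
  rw [chartGram_transition g x x' hy hy', Matrix.det_mul, Matrix.det_mul, Matrix.det_transpose,
    LinearMap.det_toMatrix, mul_comm, ← mul_assoc, ← pow_two, Real.sqrt_mul (sq_nonneg _),
    Real.sqrt_sq_eq_abs]

variable [MeasurableSpace M] [BorelSpace M]

/-- The Riemannian measure of the domain of the chart at `x`: the image under the inverse chart of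
`√(det g_ij) dy`, as a measure on `M` that vanishes off the domain of the chart. -/
def chartMeasure (g : SmoothMetric n M) (x : M) : Measure M :=
  ((volume.withDensity fun y => ENNReal.ofReal √(chartGram g x y).det).restrict
    (chartAt (EucSpace n) x).target).map (chartAt (EucSpace n) x).symm

/-- The Riemannian measure `μ_g`: the least measure that dominates the measures of all the charts.
By `riemannianMeasure_apply` it is `√(det g_ij) dy` in every chart. -/
def riemannianMeasure (g : SmoothMetric n M) : Measure M := ⨆ x, chartMeasure g x

lemma aemeasurable_chart_symm (x : M) (μ : Measure (EucSpace n)) :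
    AEMeasurable (chartAt (EucSpace n) x).symm (μ.restrict (chartAt (EucSpace n) x).target) :=
  (chartAt (EucSpace n) x).continuousOn_symm.aemeasurable
    (chartAt (EucSpace n) x).open_target.measurableSet

lemma chartMeasure_apply (g : SmoothMetric n M) (x : M) {s : Set M} (hs : MeasurableSet s) :
    chartMeasure g x s = ∫⁻ y in (chartAt (EucSpace n) x).target ∩
      (chartAt (EucSpace n) x).symm ⁻¹' s, ENNReal.ofReal √(chartGram g x y).det := by
  rw [chartMeasure, Measure.map_apply_of_aemeasurable (aemeasurable_chart_symm x _) hs,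
    Measure.restrict_apply' (chartAt (EucSpace n) x).open_target.measurableSet,
    withDensity_apply', inter_comm]

lemma chartMeasure_congr (g : SmoothMetric n M) (x x' : M) {s : Set M} (hs : MeasurableSet s)
    (h : s ⊆ (chartAt (EucSpace n) x).source) (h' : s ⊆ (chartAt (EucSpace n) x').source) :
    chartMeasure g x s = chartMeasure g x' s := by
  rw [chartMeasure_apply g x hs, chartMeasure_apply g x' hs]
  set e := chartAt (EucSpace n) x
  set e' := chartAt (EucSpace n) x'
  have himg : e'.target ∩ e'.symm ⁻¹' s = (e' ∘ e.symm) '' (e.target ∩ e.symm ⁻¹' s) := by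
    rw [← e.image_eq_target_inter_inv_preimage h, ← e'.image_eq_target_inter_inv_preimage h',
      ← image_comp]
    refine image_congr fun p hp => ?_
    exact congrArg e' (e.left_inv (h hp)).symm
  have hinj : InjOn (e' ∘ e.symm) (e.target ∩ e.symm ⁻¹' s) := by
    intro a ha b hb hab
    exact e.symm.injOn ha.1 hb.1 (e'.injOn (h' ha.2) (h' hb.2) hab)
  have hms : MeasurableSet (e.target ∩ e.symm ⁻¹' s) := by
    have h1 : MeasurableSet (e.target.domRestrict e.symm ⁻¹' s) :=
      (continuousOn_iff_continuous_domRestrict.1 e.continuousOn_symm).measurable hs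
    have h2 := e.open_target.measurableSet.subtype_image h1
    convert! h2 using 1
    ext z
    simp [and_comm]
  rw [himg, lintegral_image_eq_lintegral_abs_det_fderiv_mul volume hms
    (fun y hy => (chartTransition_hasFDerivAt x x' hy.1 (h' hy.2)).hasFDerivWithinAt) hinj]
  refine setLIntegral_congr_fun hms fun y hy => ?_
  rw [sqrt_det_chartGram_transition g x x' hy.1 (h' hy.2), ENNReal.ofReal_mul (abs_nonneg _)]

/-- In the domain of the chart at `x`, the Riemannian measure is `√(det g_ij) dy`. -/
theorem riemannianMeasure_apply (g : SmoothMetric n M) (x : M) {s : Set M} (hs : MeasurableSet s)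
    (h : s ⊆ (chartAt (EucSpace n) x).source) :
    riemannianMeasure g s = chartMeasure g x s := by
  refine le_antisymm ?_ (Measure.le_iff'.1 (le_iSup (chartMeasure g) x) s)
  have hsrc := (chartAt (EucSpace n) x).open_source.measurableSet
  have hub : riemannianMeasure g ≤ chartMeasure g x +
      ((⊤ : ℝ≥0∞) • Measure.count).restrict (chartAt (EucSpace n) x).sourceᶜ := by
    refine iSup_le fun x' => Measure.le_iff.2 fun u hu => ?_
    have hconc : chartMeasure g x' (u ∩ (chartAt (EucSpace n) x).source) ≤
        chartMeasure g x (u ∩ (chartAt (EucSpace n) x).source) := by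
      have hsrc' := (chartAt (EucSpace n) x').open_source.measurableSet
      have h0 : chartMeasure g x' (u ∩ (chartAt (EucSpace n) x).source) ≤
          chartMeasure g x' (u ∩ (chartAt (EucSpace n) x).source ∩
            (chartAt (EucSpace n) x').source) := by
        rw [chartMeasure_apply g x' (hu.inter hsrc), chartMeasure_apply g x' ((hu.inter hsrc).inter hsrc')]
        refine lintegral_mono_set fun y hy => ⟨hy.1, hy.2, (chartAt (EucSpace n) x').map_target hy.1⟩
      refine h0.trans ?_
      rw [chartMeasure_congr g x' x ((hu.inter hsrc).inter hsrc') inter_subset_right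
        (inter_subset_left.trans inter_subset_right)]
      exact measure_mono inter_subset_left
    rw [Measure.add_apply, ← measure_inter_add_sdiff u hsrc]
    refine add_le_add (hconc.trans (measure_mono inter_subset_left)) ?_
    rw [Measure.restrict_apply hu]
    rcases (u ∩ (chartAt (EucSpace n) x).sourceᶜ).eq_empty_or_nonempty with h0 | h0
    · rw [sdiff_eq, h0]; simp
    · have : Measure.count (u ∩ (chartAt (EucSpace n) x).sourceᶜ) ≠ 0 := by
        rw [Measure.count_ne_zero_iff]
        exact h0
      rw [Measure.smul_apply, smul_eq_mul, ENNReal.top_mul this]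
      exact le_top
  refine (Measure.le_iff'.1 hub s).trans ?_
  rw [Measure.add_apply, Measure.restrict_apply hs]
  have : s ∩ (chartAt (EucSpace n) x).sourceᶜ = ∅ := by
    rw [← sdiff_eq, sdiff_eq_empty]; exact h
  simp [this]

instance isLocallyFiniteMeasure_riemannianMeasure (g : SmoothMetric n M) :
    IsLocallyFiniteMeasure (riemannianMeasure g) := by
  refine ⟨fun p => ?_⟩
  set e := chartAt (EucSpace n) p with he
  have hp : e p ∈ e.target := e.map_source (mem_chart_source _ p)
  obtain ⟨r, hr, hball⟩ := Metric.nhds_basis_closedBall.mem_iff.1 (e.open_target.mem_nhds hp)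
  refine ⟨e.source ∩ e ⁻¹' Metric.ball (e p) r, ?_, ?_⟩
  · exact (e.isOpen_inter_preimage Metric.isOpen_ball).mem_nhds
      ⟨mem_chart_source _ p, Metric.mem_ball_self hr⟩
  · have hms : MeasurableSet (e.source ∩ e ⁻¹' Metric.ball (e p) r) :=
      (e.isOpen_inter_preimage Metric.isOpen_ball).measurableSet
    rw [riemannianMeasure_apply g p hms inter_subset_left, chartMeasure_apply g p hms]
    have hcont : ContinuousOn (fun y => √(chartGram g p y).det) e.target := by
      refine Real.continuous_sqrt.comp_continuousOn ?_
      have : ContinuousOn (fun y => chartGram g p y) e.target :=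
        continuousOn_pi.2 fun i => continuousOn_pi.2 fun j => continuousOn_chartGram_apply g p i j
      exact (continuous_id.matrix_det).comp_continuousOn this
    obtain ⟨C, hC⟩ := ((isCompact_closedBall (e p) r).image_of_continuousOn
      (hcont.mono hball)).isBounded.subset_closedBall 0
    have hsub : e.target ∩ e.symm ⁻¹' (e.source ∩ e ⁻¹' Metric.ball (e p) r) ⊆
        Metric.closedBall (e p) r := by
      rintro y ⟨hy, -, hy2⟩
      rw [mem_preimage, e.right_inv hy] at hy2
      exact Metric.ball_subset_closedBall hy2
    calc _ ≤ ∫⁻ y in Metric.closedBall (e p) r, ENNReal.ofReal √(chartGram g p y).det :=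
          lintegral_mono_set hsub
      _ ≤ ∫⁻ y in Metric.closedBall (e p) r, ENNReal.ofReal C := by
          refine setLIntegral_mono' Metric.isClosed_closedBall.measurableSet fun y hy => ?_
          refine ENNReal.ofReal_le_ofReal ?_
          have := hC (mem_image_of_mem _ hy)
          rw [mem_closedBall_zero_iff] at this
          exact (le_abs_self _).trans this
      _ < (⊤ : ℝ≥0∞) := by
          rw [setLIntegral_const]
          exact ENNReal.mul_lt_top ENNReal.ofReal_lt_top measure_closedBall_lt_top


end RiemannianMeasure

section Dirichlet

variable {n : ℕ} {M : Type*} [TopologicalSpace M] [ChartedSpace (EucSpace n) M]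
  [IsManifold (𝓡 n) ∞ M]

/-- The matrix of `g_p` in the standard basis of the tangent space at `p`. -/
def metricMatrix (g : SmoothMetric n M) (p : M) : Matrix (Fin n) (Fin n) ℝ :=
  Matrix.of fun i j => g.inner p (EuclideanSpace.single i (1 : ℝ) : EucSpace n)
    (EuclideanSpace.single j (1 : ℝ) : EucSpace n)

/-- The components of the differential `du_p` in the standard basis of the tangent space at `p`. -/
def diffComponents (n : ℕ) {M : Type*} [TopologicalSpace M] [ChartedSpace (EucSpace n) M]
    (u : M → ℂ) (p : M) : Fin n → ℂ := fun i =>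
  mfderiv (𝓡 n) 𝓘(ℝ, ℂ) u p (EuclideanSpace.single i (1 : ℝ) : EucSpace n)

/-- The pairing `⟨∇u, ∇v⟩_g = g^{ij} (conj ∂_i u) (∂_j v)` of the gradients of two complex functions.
Its value does not depend on the basis of the tangent space (see `gradInner_chart`). -/
def gradInner (g : SmoothMetric n M) (u v : M → ℂ) (p : M) : ℂ :=
  star (diffComponents n u p) ⬝ᵥ
    ((metricMatrix g p)⁻¹.map (algebraMap ℝ ℂ)).mulVec (diffComponents n v p)

lemma metricMatrix_posDef (g : SmoothMetric n M) (p : M) : (metricMatrix g p).PosDef := by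
  refine Matrix.PosDef.of_dotProduct_mulVec_pos ?_ fun v hv => ?_
  · ext i j
    simp only [Matrix.conjTranspose_apply, star_trivial]
    exact g.symm _ _ _
  · have hw : (WithLp.toLp 2 v : EucSpace n) =
        ∑ i, v i • (EuclideanSpace.single i (1 : ℝ) : EucSpace n) := by
      ext m
      simp [Pi.single_apply]
    have hne : (WithLp.toLp 2 v : EucSpace n) ≠ 0 := fun h0 => hv (by simpa using h0)
    refine (g.pos p _ hne).trans_eq ?_
    rw [hw]
    exact (bilin_sum_sum (g.inner p) _ _ _).trans
      (by simp only [dotProduct, Matrix.mulVec, star_trivial]; rfl)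

lemma hermForm_re_nonneg {m : ℕ} {S : Matrix (Fin m) (Fin m) ℝ} (hS : S.PosSemidef)
    (w : Fin m → ℂ) : 0 ≤ (star w ⬝ᵥ (S.map (algebraMap ℝ ℂ)).mulVec w).re := by
  have h1 := hS.dotProduct_mulVec_nonneg (fun i => (w i).re)
  have h2 := hS.dotProduct_mulVec_nonneg (fun i => (w i).im)
  refine (add_nonneg h1 h2).trans_eq ?_
  simp only [dotProduct, Matrix.mulVec, star_trivial, Complex.re_sum, Pi.star_apply,
    Matrix.map_apply, Complex.mul_re, Complex.im_sum, Complex.mul_im, Complex.star_def,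
    Complex.conj_re, Complex.conj_im, Complex.coe_algebraMap, Complex.ofReal_re, Complex.ofReal_im,
    zero_mul, sub_zero, add_zero, neg_mul, sub_neg_eq_add, Finset.sum_add_distrib]

lemma hermForm_star {m : ℕ} {S : Matrix (Fin m) (Fin m) ℝ} (hS : S.IsHermitian)
    (v w : Fin m → ℂ) : star (star v ⬝ᵥ (S.map (algebraMap ℝ ℂ)).mulVec w) =
      star w ⬝ᵥ (S.map (algebraMap ℝ ℂ)).mulVec v := by
  simp only [dotProduct, Matrix.mulVec, Finset.mul_sum, star_sum]
  rw [Finset.sum_comm]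
  refine Finset.sum_congr rfl fun i _ => Finset.sum_congr rfl fun j _ => ?_
  have : S i j = S j i := by simpa using hS.apply j i
  simp [this]
  ring

lemma gradInner_self_nonneg (g : SmoothMetric n M) (u : M → ℂ) (p : M) :
    0 ≤ (gradInner g u u p).re :=
  hermForm_re_nonneg (metricMatrix_posDef g p).inv.posSemidef _

lemma gradInner_conj_symm (g : SmoothMetric n M) (u v : M → ℂ) (p : M) :
    star (gradInner g v u p) = gradInner g u v p :=
  hermForm_star (metricMatrix_posDef g p).inv.isHermitian _ _

lemma diffComponents_add {u v : M → ℂ} (hu : ContMDiff (𝓡 n) 𝓘(ℝ, ℂ) ∞ u)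
    (hv : ContMDiff (𝓡 n) 𝓘(ℝ, ℂ) ∞ v) (p : M) :
    diffComponents n (u + v) p = diffComponents n u p + diffComponents n v p := by
  ext i
  have := mfderiv_add (hu.mdifferentiableAt (x := p) (by simp))
    (hv.mdifferentiableAt (x := p) (by simp))
  exact DFunLike.congr_fun this _

lemma diffComponents_smul {u : M → ℂ} (hu : ContMDiff (𝓡 n) 𝓘(ℝ, ℂ) ∞ u) (c : ℂ) (p : M) :
    diffComponents n (c • u) p = c • diffComponents n u p := by
  ext i
  have h1 := mfderiv_comp (I := 𝓡 n) (I' := 𝓘(ℝ, ℂ)) (I'' := 𝓘(ℝ, ℂ)) p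
    (g := ContinuousLinearMap.mul ℝ ℂ c) (f := u)
    (ContinuousLinearMap.mul ℝ ℂ c).mdifferentiableAt (hu.mdifferentiableAt (by simp))
  rw [ContinuousLinearMap.mfderiv_eq] at h1
  exact DFunLike.congr_fun h1 _

lemma mfderiv_chart_symm_comp {u : M → ℂ} (hu : ContMDiff (𝓡 n) 𝓘(ℝ, ℂ) ∞ u) (x : M)
    {y : EucSpace n} (hy : y ∈ (chartAt (EucSpace n) x).target) (v : EucSpace n) :
    (fderiv ℝ (u ∘ (chartAt (EucSpace n) x).symm) y v : ℂ) =
      mfderiv (𝓡 n) 𝓘(ℝ, ℂ) u ((chartAt (EucSpace n) x).symm y)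
        (mfderiv (𝓡 n) (𝓡 n) (chartAt (EucSpace n) x).symm y v) := by
  have h1 : ContMDiffAt (𝓡 n) (𝓡 n) ∞ (chartAt (EucSpace n) x).symm y :=
    contMDiffOn_chart_symm.contMDiffAt ((chartAt (EucSpace n) x).open_target.mem_nhds hy)
  have h6 := mfderiv_comp (I := 𝓡 n) (I' := 𝓡 n) (I'' := 𝓘(ℝ, ℂ)) y
    (hu.mdifferentiableAt (by simp)) (h1.mdifferentiableAt (by simp))
  rw [← mfderiv_eq_fderiv]
  exact DFunLike.congr_fun h6 v

lemma hermForm_frame {m : ℕ} {S P : Matrix (Fin m) (Fin m) ℝ} (hP : IsUnit P.det)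
    (v w : Fin m → ℂ) :
    star ((P.map (algebraMap ℝ ℂ)).transpose.mulVec v) ⬝ᵥ
      ((P.transpose * S * P)⁻¹.map (algebraMap ℝ ℂ)).mulVec
        ((P.map (algebraMap ℝ ℂ)).transpose.mulVec w) =
    star v ⬝ᵥ (S⁻¹.map (algebraMap ℝ ℂ)).mulVec w := by
  have h1 : (P.transpose * S * P)⁻¹ = P⁻¹ * S⁻¹ * P.transpose⁻¹ := by
    rw [Matrix.mul_inv_rev, Matrix.mul_inv_rev, Matrix.mul_assoc]
  have h2 : star ((P.map (algebraMap ℝ ℂ)).transpose.mulVec v) =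
      Matrix.vecMul (star v) (P.map (algebraMap ℝ ℂ)) := by
    rw [Matrix.star_mulVec]
    congr 1
    ext i j
    simp
  rw [h1, h2, ← Matrix.dotProduct_mulVec, Matrix.mulVec_mulVec, Matrix.mulVec_mulVec,
    ← Matrix.transpose_map, ← Matrix.map_mul, ← Matrix.map_mul]
  congr 4
  have h3 : IsUnit P.transpose.det := by rwa [Matrix.det_transpose]
  rw [Matrix.mul_assoc P⁻¹, ← Matrix.mul_assoc P, Matrix.mul_nonsing_inv _ hP, Matrix.one_mul,
    Matrix.mul_assoc, Matrix.nonsing_inv_mul _ h3, Matrix.mul_one]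

/-- The expression of `gradInner` in a chart. -/
lemma gradInner_chart (g : SmoothMetric n M) {u v : M → ℂ} (hu : ContMDiff (𝓡 n) 𝓘(ℝ, ℂ) ∞ u)
    (hv : ContMDiff (𝓡 n) 𝓘(ℝ, ℂ) ∞ v) (x : M) {y : EucSpace n}
    (hy : y ∈ (chartAt (EucSpace n) x).target) :
    gradInner g u v ((chartAt (EucSpace n) x).symm y) =
      star (fun i => fderiv ℝ (u ∘ (chartAt (EucSpace n) x).symm) y
        (EuclideanSpace.single i (1 : ℝ))) ⬝ᵥ
      ((chartGram g x y)⁻¹.map (algebraMap ℝ ℂ)).mulVec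
        (fun i => fderiv ℝ (v ∘ (chartAt (EucSpace n) x).symm) y
        (EuclideanSpace.single i (1 : ℝ))) := by
  set p := (chartAt (EucSpace n) x).symm y with hp
  let fr : Fin n → EucSpace n := fun i => chartFrame x y i
  set P : Matrix (Fin n) (Fin n) ℝ := Matrix.of fun k i => fr i k with hPdef
  have hexp : ∀ i, fr i =
      ∑ k, P k i • (EuclideanSpace.single k (1 : ℝ) : EucSpace n) := by
    intro i
    ext m
    simp [P, Pi.single_apply]
  have hG : chartGram g x y = P.transpose * metricMatrix g p * P := by
    ext i j
    have h3 : chartGram g x y i j = g.inner p (fr i) (fr j) := rfl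
    rw [h3, hexp i, hexp j, Matrix.mul_assoc]
    simp only [Matrix.mul_apply, Matrix.transpose_apply]
    exact bilin_sum_sum (g.inner p) _ _ _
  have hPdet : IsUnit P.det := by
    have h1 := (chartGram_posDef g x hy).det_pos
    rw [hG, Matrix.det_mul] at h1
    exact isUnit_iff_ne_zero.2 (right_ne_zero_of_mul h1.ne')
  have hcomp : ∀ {f : M → ℂ}, ContMDiff (𝓡 n) 𝓘(ℝ, ℂ) ∞ f →
      (fun i => fderiv ℝ (f ∘ (chartAt (EucSpace n) x).symm) y
        (EuclideanSpace.single i (1 : ℝ))) =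
      (P.map (algebraMap ℝ ℂ)).transpose.mulVec (diffComponents n f p) := by
    intro f hf
    ext i
    rw [mfderiv_chart_symm_comp hf x hy]
    have h4 : (mfderiv (𝓡 n) (𝓡 n) (chartAt (EucSpace n) x).symm y
      (EuclideanSpace.single i (1 : ℝ) : EucSpace n) : EucSpace n) = _ := hexp i
    refine (congrArg (mfderiv (𝓡 n) 𝓘(ℝ, ℂ) f p) h4).trans ?_
    refine (map_sum _ _ _).trans ?_
    simp only [Matrix.mulVec, dotProduct, Matrix.transpose_apply, Matrix.map_apply]
    refine Finset.sum_congr rfl fun k _ => ?_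
    refine (map_smul _ _ _).trans ?_
    exact Complex.real_smul
  rw [hcomp hu, hcomp hv, hG, hermForm_frame hPdet]
  rfl

lemma continuous_gradInner (g : SmoothMetric n M) {u v : M → ℂ}
    (hu : ContMDiff (𝓡 n) 𝓘(ℝ, ℂ) ∞ u) (hv : ContMDiff (𝓡 n) 𝓘(ℝ, ℂ) ∞ v) :
    Continuous (gradInner g u v) := by
  refine continuous_iff_continuousAt.2 fun x => ?_
  set e := chartAt (EucSpace n) x with he
  have hpart : ∀ {f : M → ℂ}, ContMDiff (𝓡 n) 𝓘(ℝ, ℂ) ∞ f → ∀ i : Fin n,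
      ContinuousOn (fun y => fderiv ℝ (f ∘ e.symm) y (EuclideanSpace.single i (1 : ℝ))) e.target := by
    intro f hf i
    have h1 : ContMDiffOn (𝓡 n) 𝓘(ℝ, ℂ) ∞ (f ∘ e.symm) e.target :=
      hf.comp_contMDiffOn contMDiffOn_chart_symm
    have h2 := (contMDiffOn_iff_contDiffOn.1 h1).continuousOn_fderiv_of_isOpen e.open_target
      (by simp)
    exact h2.clm_apply continuousOn_const
  have hinv : ∀ i j, ContinuousOn (fun y => ((chartGram g x y)⁻¹ i j)) e.target := by
    intro i j
    have h0 : ContinuousOn (fun y => chartGram g x y) e.target :=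
      continuousOn_pi.2 fun i => continuousOn_pi.2 fun j => continuousOn_chartGram_apply g x i j
    have h1 : ContinuousOn (fun y => (chartGram g x y).det) e.target :=
      (continuous_id.matrix_det).comp_continuousOn h0
    have h2 : ContinuousOn (fun y => (chartGram g x y).adjugate i j) e.target :=
      ((continuous_id.matrix_adjugate).matrix_elem i j).comp_continuousOn h0
    have h3 : (fun y => ((chartGram g x y)⁻¹ i j)) =
        fun y => ((chartGram g x y).det)⁻¹ * (chartGram g x y).adjugate i j := by
      ext y
      rw [Matrix.inv_def, Matrix.smul_apply, Ring.inverse_eq_inv', smul_eq_mul]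
    rw [h3]
    exact (h1.inv₀ fun y hy => (chartGram_posDef g x hy).det_pos.ne').mul h2
  have hF : ContinuousOn (fun y => star (fun i => fderiv ℝ (u ∘ e.symm) y
        (EuclideanSpace.single i (1 : ℝ))) ⬝ᵥ
      ((chartGram g x y)⁻¹.map (algebraMap ℝ ℂ)).mulVec
        (fun i => fderiv ℝ (v ∘ e.symm) y
        (EuclideanSpace.single i (1 : ℝ)))) e.target := by
    simp only [dotProduct, Matrix.mulVec, Pi.star_apply, Matrix.map_apply]
    refine continuousOn_finsetSum _ fun i _ => (hpart hu i).star.mul ?_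
    refine continuousOn_finsetSum _ fun j _ => ContinuousOn.mul ?_ (hpart hv j)
    exact Complex.continuous_ofReal.comp_continuousOn (hinv i j)
  have h1 : ContinuousOn (gradInner g u v) e.source := by
    refine (hF.comp e.continuousOn (fun p hp => e.map_source hp)).congr fun p hp => ?_
    have := gradInner_chart g hu hv x (e.map_source hp)
    rw [e.left_inv hp] at this
    exact this
  exact h1.continuousAt (e.open_source.mem_nhds (mem_chart_source _ x))

lemma diffComponents_eq_zero {u : M → ℂ} {p : M} (hp : p ∉ tsupport u) :
    diffComponents n u p = 0 := by
  have h1 : u =ᶠ[𝓝 p] fun _ => 0 := notMem_tsupport_iff_eventuallyEq.1 hp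
  have h2 := h1.mfderiv_eq (I := 𝓡 n) (I' := 𝓘(ℝ, ℂ))
  rw [mfderiv_const] at h2
  ext i
  exact DFunLike.congr_fun h2 _

lemma hasCompactSupport_gradInner (g : SmoothMetric n M) {u v : M → ℂ}
    (hv : HasCompactSupport v) : HasCompactSupport (gradInner g u v) := by
  refine hv.mono' fun p hp => ?_
  by_contra h
  exact hp (by simp [gradInner, diffComponents_eq_zero h])

/-- `C_c^∞(Ω)`: smooth complex functions on `M` with compact support inside `Ω`. -/
def testFunctions (n : ℕ) {M : Type*} [TopologicalSpace M] [ChartedSpace (EucSpace n) M]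
    (Ω : Set M) : Submodule ℂ (M → ℂ) where
  carrier := {u | ContMDiff (𝓡 n) 𝓘(ℝ, ℂ) ∞ u ∧ HasCompactSupport u ∧ tsupport u ⊆ Ω}
  add_mem' := by
    rintro u v ⟨hu, hu1, hu2⟩ ⟨hv, hv1, hv2⟩
    exact ⟨hu.add hv, hu1.add hv1, (tsupport_add u v).trans (union_subset hu2 hv2)⟩
  zero_mem' := ⟨contMDiff_const, HasCompactSupport.zero, by simp [tsupport]⟩
  smul_mem' := by
    rintro c u ⟨hu, hu1, hu2⟩
    refine ⟨?_, hu1.smul_left (f := fun _ => c), (tsupport_smul_subset_right (fun _ => c) u).trans hu2⟩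
    exact (((ContinuousLinearMap.mul ℝ ℂ c).contMDiff).comp hu)


variable [MeasurableSpace M] [BorelSpace M]

lemma testFunctions_memLp {g : SmoothMetric n M} {Ω : Set M} {u : M → ℂ}
    (hu : u ∈ testFunctions n Ω) :
    MemLp u 2 ((riemannianMeasure g).restrict Ω) :=
  (hu.1.continuous.memLp_of_hasCompactSupport hu.2.1).restrict Ω

lemma testFunctions_integrable_gradInner (g : SmoothMetric n M) {Ω : Set M} {u v : M → ℂ}
    (hu : u ∈ testFunctions n Ω) (hv : v ∈ testFunctions n Ω) :
    Integrable (gradInner g u v) ((riemannianMeasure g).restrict Ω) :=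
  ((continuous_gradInner g hu.1 hv.1).integrable_of_hasCompactSupport
    (hasCompactSupport_gradInner g hv.2.1)).restrict

/-- `C_c^∞(Ω)`, as a space that carries the form inner product `⟨u, v⟩_{L²} + E[u, v]`. -/
def TestSpace (_g : SmoothMetric n M) (Ω : Set M) : Type _ := testFunctions n Ω

instance (g : SmoothMetric n M) (Ω : Set M) : AddCommGroup (TestSpace g Ω) :=
  inferInstanceAs (AddCommGroup (testFunctions n Ω))

instance (g : SmoothMetric n M) (Ω : Set M) : Module ℂ (TestSpace g Ω) :=
  inferInstanceAs (Module ℂ (testFunctions n Ω))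

/-- The `L²(Ω)` class of a test function. -/
def testToLp (g : SmoothMetric n M) (Ω : Set M) :
    TestSpace g Ω →ₗ[ℂ] Lp ℂ 2 ((riemannianMeasure g).restrict Ω) where
  toFun u := (testFunctions_memLp (g := g) u.2).toLp u.1
  map_add' _ _ := MemLp.toLp_add _ _
  map_smul' c _ := MemLp.toLp_const_smul c _

/-- The Dirichlet form `E[u, v] = ∫_Ω ⟨∇u, ∇v⟩_g dμ_g` on test functions. -/
def dirichletForm (g : SmoothMetric n M) (Ω : Set M) (u v : TestSpace g Ω) : ℂ :=
  ∫ x in Ω, gradInner g u.1 v.1 x ∂(riemannianMeasure g)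

/-- The form inner product `⟨u, v⟩_{L²(Ω)} + E[u, v]`. -/
abbrev formCore (g : SmoothMetric n M) (Ω : Set M) :
    PreInnerProductSpace.Core ℂ (TestSpace g Ω) where
  inner u v := inner ℂ (testToLp g Ω u) (testToLp g Ω v) + dirichletForm g Ω u v
  conj_inner_symm u v := by
    rw [map_add, inner_conj_symm, dirichletForm, ← integral_conj]
    congr 1
    exact integral_congr_ae (ae_of_all _ fun x => gradInner_conj_symm g u.1 v.1 x)
  re_inner_nonneg u := by
    rw [map_add]
    refine add_nonneg inner_self_nonneg ?_
    have h := integral_re (testFunctions_integrable_gradInner g u.2 u.2)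
    refine (integral_nonneg fun x => ?_).trans_eq h
    exact gradInner_self_nonneg g u.1 x
  add_left u v w := by
    have h : dirichletForm g Ω (u + v) w = dirichletForm g Ω u w + dirichletForm g Ω v w := by
      rw [dirichletForm, dirichletForm, dirichletForm,
        ← integral_add (testFunctions_integrable_gradInner g u.2 w.2)
          (testFunctions_integrable_gradInner g v.2 w.2)]
      refine integral_congr_ae (ae_of_all _ fun x => ?_)
      have h1 : diffComponents n (u + v).1 x = _ := diffComponents_add u.2.1 v.2.1 x
      simp only [gradInner]
      rw [h1, star_add, add_dotProduct]
    rw [map_add, inner_add_left, h]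
    ring
  smul_left u v c := by
    have h : dirichletForm g Ω (c • u) v = star c * dirichletForm g Ω u v := by
      rw [dirichletForm, dirichletForm, ← integral_const_mul]
      refine integral_congr_ae (ae_of_all _ fun x => ?_)
      have h1 : diffComponents n (c • u).1 x = _ := diffComponents_smul u.2.1 c x
      simp only [gradInner]
      rw [h1, star_smul, smul_dotProduct, smul_eq_mul]
    rw [map_smul, inner_smul_left, h, mul_add]
    rfl

instance (g : SmoothMetric n M) (Ω : Set M) : SeminormedAddCommGroup (TestSpace g Ω) :=
  InnerProductSpace.Core.toSeminormedAddCommGroup (c := formCore g Ω)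

instance (g : SmoothMetric n M) (Ω : Set M) : InnerProductSpace ℂ (TestSpace g Ω) :=
  InnerProductSpace.ofCore (formCore g Ω)

lemma testSpace_inner_def (g : SmoothMetric n M) (Ω : Set M) (u v : TestSpace g Ω) :
    inner ℂ u v = inner ℂ (testToLp g Ω u) (testToLp g Ω v) + dirichletForm g Ω u v := rfl

lemma norm_testToLp_le (g : SmoothMetric n M) (Ω : Set M) (u : TestSpace g Ω) :
    ‖testToLp g Ω u‖ ≤ 1 * ‖u‖ := by
  rw [one_mul, ← sq_le_sq₀ (norm_nonneg _) (norm_nonneg _), ← inner_self_eq_norm_sq (𝕜 := ℂ),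
    ← inner_self_eq_norm_sq (𝕜 := ℂ) u, testSpace_inner_def, map_add]
  refine le_add_of_nonneg_right ?_
  have h := integral_re (testFunctions_integrable_gradInner g u.2 u.2)
  refine (integral_nonneg fun x => ?_).trans_eq h
  exact gradInner_self_nonneg g u.1 x

/-- The inclusion of `C_c^∞(Ω)`, with the form norm, in `L²(Ω)`. -/
def testInclusion (g : SmoothMetric n M) (Ω : Set M) :
    TestSpace g Ω →L[ℂ] Lp ℂ 2 ((riemannianMeasure g).restrict Ω) :=
  (testToLp g Ω).mkContinuous 1 (norm_testToLp_le g Ω)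

end Dirichlet

section Heat

variable {V H : Type*} [SeminormedAddCommGroup V] [InnerProductSpace ℂ V]
  [NormedAddCommGroup H] [InnerProductSpace ℂ H] [CompleteSpace H]

/-- The continuous extension `J` of an inclusion of a form core in a Hilbert space to the completion
of the core; for `C_c^∞(Ω)` in `L²(Ω)` this is the inclusion `J : H^1_0(Ω) → L²(Ω)`. -/
def formInclusion (ι : V →L[ℂ] H) : UniformSpace.Completion V →L[ℂ] H :=
  ι.extend UniformSpace.Completion.toComplL

lemma formInclusion_coe (ι : V →L[ℂ] H) (v : V) : formInclusion ι v = ι v :=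
  ContinuousLinearMap.extend_eq _ UniformSpace.Completion.denseRange_coe
    (UniformSpace.Completion.isUniformInducing_coe V) v

/-- The operator `J J^*`. If `H` is the nonnegative selfadjoint operator of the closed form `E`, then
`⟨J^* f, v⟩_{H^1_0} = ⟨f, v⟩_{L²}` for all `v` in the form domain says that `J J^* = (1 + H)⁻¹`. -/
def formResolvent (ι : V →L[ℂ] H) : H →L[ℂ] H :=
  formInclusion ι ∘L ContinuousLinearMap.adjoint (formInclusion ι)

/-- The function `r ↦ e^{-τ (1/r - 1)}`, extended by `0` to `r ≤ 0`; at `r = 1/(1 + l)` its value is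
`e^{-τ l}`. -/
def heatProfile (τ x : ℝ) : ℝ := if 0 < x then Real.exp (-τ * (x⁻¹ - 1)) else 0

lemma continuous_heatProfile {τ : ℝ} (hτ : 0 < τ) : Continuous (heatProfile τ) := by
  have h : heatProfile τ = fun x => Real.exp τ * expNegInvGlue (x / τ) := by
    ext x
    unfold heatProfile expNegInvGlue
    by_cases hx : 0 < x
    · rw [if_pos hx, if_neg (not_le.2 (by positivity)), ← Real.exp_add]
      congr 1
      field_simp
      ring
    · rw [if_neg hx, if_pos (div_nonpos_of_nonpos_of_nonneg (not_lt.1 hx) hτ.le), mul_zero]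
  rw [h]
  exact continuous_const.mul (expNegInvGlue.contDiff (n := 0).continuous.comp
    (continuous_id.div_const τ))

lemma isSelfAdjoint_formResolvent (ι : V →L[ℂ] H) : IsSelfAdjoint (formResolvent ι) := by
  rw [ContinuousLinearMap.isSelfAdjoint_iff', formResolvent, ContinuousLinearMap.adjoint_comp,
    ContinuousLinearMap.adjoint_adjoint]

/-- The heat operator `e^{-τ H}` (`τ > 0`) of the closed form with core inclusion `ι`, through the
continuous functional calculus of the bounded selfadjoint operator `(1 + H)⁻¹`. -/
def formHeat (ι : V →L[ℂ] H) (τ : ℝ) : H →L[ℂ] H :=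
  cfc (p := IsSelfAdjoint) (heatProfile τ) (formResolvent ι)

end Heat

section DirichletHeat

variable {n : ℕ} {M : Type*} [TopologicalSpace M] [ChartedSpace (EucSpace n) M]
  [IsManifold (𝓡 n) ∞ M] [MeasurableSpace M] [BorelSpace M]

/-- The heat operator `e^{-τ H}` on `L²(Ω, μ_g)`, where `H` is the Friedrichs (Dirichlet) realization of
`-Δ_g` on `Ω`, i.e. the operator of `E[u] = ∫_Ω |∇u|² dμ_g` with domain `H^1_0(Ω)`. -/
def dirichletHeat (g : SmoothMetric n M) (Ω : Set M) (τ : ℝ) :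
    Lp ℂ 2 ((riemannianMeasure g).restrict Ω) →L[ℂ] Lp ℂ 2 ((riemannianMeasure g).restrict Ω) :=
  formHeat (testInclusion g Ω) τ

end DirichletHeat

section Fibration


open InnerProductSpace Laplacian

/-- The first nonzero eigenvalue of the nonnegative Laplacian on the flat torus `ℝ² / Λ`, where `Λ` is
the lattice with basis `L`: functions on the torus are `Λ`-periodic functions on the plane. -/
def torusLambdaOne (L : Module.Basis (Fin 2) ℝ (EucSpace 2)) : ℝ :=
  sInf {l : ℝ | 0 < l ∧ ∃ f : EucSpace 2 → ℝ, ContDiff ℝ ∞ f ∧ f ≠ 0 ∧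
    (∀ z ∈ Submodule.span ℤ (range L), ∀ x, f (x + z) = f x) ∧
    ∀ x, -(Δ f) x = l * f x}

/-- A smooth fibration of a 4-manifold `X` over a surface `B` (the regular locus), together with a
horizontal/vertical splitting and flat metrics along the fibers over the open set `B₀`, for which
these fibers are flat 2-tori. -/
structure FlatTorusFibration {B : Type*} [TopologicalSpace B] [ChartedSpace (EucSpace 2) B]
    (B₀ : TopologicalSpace.Opens B) (X : Type*) [TopologicalSpace X]
    [ChartedSpace (EucSpace 4) X] where
  /-- The surjective submersion `Π : X → B`. -/
  proj : X → B
  contMDiff_proj : ContMDiff (𝓡 4) (𝓡 2) ∞ proj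
  surjective_proj : Function.Surjective proj
  surjective_mfderiv : ∀ x, Function.Surjective (mfderiv (𝓡 4) (𝓡 2) proj x)
  /-- The splitting: the projection of `T_x X` to the vertical space `ker dΠ_x` along the horizontal
  space. -/
  vert : ∀ x : X, TangentSpace (𝓡 4) x →L[ℝ] TangentSpace (𝓡 4) x
  vert_mem : ∀ x, proj x ∈ B₀ → ∀ v, mfderiv (𝓡 4) (𝓡 2) proj x (vert x v) = 0
  vert_eq_self : ∀ x, proj x ∈ B₀ → ∀ v, mfderiv (𝓡 4) (𝓡 2) proj x v = 0 → vert x v = v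
  /-- The fiber metric `g_F`; only its values on vertical vectors matter. -/
  fiberMetric : ∀ x : X, TangentSpace (𝓡 4) x →L[ℝ] TangentSpace (𝓡 4) x →L[ℝ] ℝ
  /-- A basis of the lattice `Λ_b` with `F_b ≅ ℝ² / Λ_b`. -/
  lattice : B → Module.Basis (Fin 2) ℝ (EucSpace 2)
  /-- The Riemannian covering `ℝ² → F_b` that identifies `(F_b, g_F)` with `ℝ² / Λ_b`. -/
  param : B → EucSpace 2 → X
  contMDiff_param : ∀ b ∈ B₀, ContMDiff (𝓡 2) (𝓡 4) ∞ (param b)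
  range_param : ∀ b ∈ B₀, range (param b) = proj ⁻¹' {b}
  param_eq_iff : ∀ b ∈ B₀, ∀ a a', param b a = param b a' ↔
    a - a' ∈ Submodule.span ℤ (range (lattice b))
  param_isometry : ∀ b ∈ B₀, ∀ a (v w : EucSpace 2),
    fiberMetric (param b a) (mfderiv (𝓡 2) (𝓡 4) (param b) a v)
      (mfderiv (𝓡 2) (𝓡 4) (param b) a w) = inner ℝ v w

namespace FlatTorusFibration

variable {B : Type*} [TopologicalSpace B] [ChartedSpace (EucSpace 2) B]
  {B₀ : TopologicalSpace.Opens B} {X : Type*} [TopologicalSpace X] [ChartedSpace (EucSpace 4) X]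

/-- `X_{t,0}`, the part of the total space over `B₀`. -/
def totalSpace (F : FlatTorusFibration B₀ X) : Set X := F.proj ⁻¹' B₀

/-- `λ₁(F_b, g_F)`, the first nonzero eigenvalue of the flat torus `F_b ≅ ℝ² / Λ_b`. -/
def fiberLambdaOne (F : FlatTorusFibration B₀ X) (b : B) : ℝ := torusLambdaOne (F.lattice b)

/-- The Haar probability measure `ϑ_b` of the flat torus `F_b ≅ ℝ² / Λ_b`. -/
def fiberHaar [MeasurableSpace X] (F : FlatTorusFibration B₀ X) (b : B) : Measure X :=
  (ProbabilityTheory.cond volume (ZSpan.fundamentalDomain (F.lattice b))).map (F.param b)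

variable [IsManifold (𝓡 2) ∞ B] [IsManifold (𝓡 4) ∞ X]

/-- The product reference metric `g^Π = g_B ⊕ g_F` with respect to the splitting. -/
def refMetric (F : FlatTorusFibration B₀ X) (gB : SmoothMetric 2 B) (x : X)
    (v w : TangentSpace (𝓡 4) x) : ℝ :=
  gB.inner (F.proj x) (mfderiv (𝓡 4) (𝓡 2) F.proj x v) (mfderiv (𝓡 4) (𝓡 2) F.proj x w) +
    F.fiberMetric x (F.vert x v) (F.vert x w)

/-- `‖g - g^Π‖ ≤ ε` on `X_{t,0}` in the uniform norm with respect to `g^Π`; as `g - g^Π` is symmetric,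
its norm at a point is the supremum of its quadratic form over `g^Π`-unit vectors. -/
def SemiFlatControl (F : FlatTorusFibration B₀ X) (gB : SmoothMetric 2 B) (g : SmoothMetric 4 X)
    (ε : ℝ) : Prop :=
  ∀ x ∈ F.totalSpace, ∀ v : TangentSpace (𝓡 4) x,
    |g.inner x v v - F.refMetric gB x v v| ≤ ε * F.refMetric gB x v v

end FlatTorusFibration

variable {B : Type*} [TopologicalSpace B] [ChartedSpace (EucSpace 2) B] [IsManifold (𝓡 2) ∞ B]
  [MeasurableSpace B] [BorelSpace B] {B₀ : TopologicalSpace.Opens B}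
  {X : Type*} [TopologicalSpace X] [ChartedSpace (EucSpace 4) X] [IsManifold (𝓡 4) ∞ X]
  [MeasurableSpace X] [BorelSpace X]

/-- A normalized disintegration of `μ_g` on `X_{t,0}` along the fibers: measurable `A > 0` on `B₀` and
`ρ > 0` on `X_{t,0}` with `∫_{F_b} ρ dϑ_b = 1` and
`∫_{X_{t,0}} f dμ_g = ∫_{B₀} A(b) (∫_{F_b} f ρ dϑ_b) dμ_B(b)`. The last identity is stated for
measurable `f ≥ 0`, which is equivalent to the identity for integrable `f`; that the inner integral
is a measurable function of `b` is a part of it. -/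
structure NormalizedDisintegration (F : FlatTorusFibration B₀ X) (gB : SmoothMetric 2 B)
    (g : SmoothMetric 4 X) where
  /-- The function `A`. -/
  area : B → ℝ
  measurable_area : Measurable area
  area_pos : ∀ b ∈ B₀, 0 < area b
  /-- The function `ρ`. -/
  dens : X → ℝ
  measurable_dens : Measurable dens
  dens_pos : ∀ x ∈ F.totalSpace, 0 < dens x
  dens_normalized : ∀ b ∈ B₀, ∫⁻ x, ENNReal.ofReal (dens x) ∂F.fiberHaar b = 1
  aemeasurable_fiber : ∀ f : X → ℝ≥0∞, Measurable f →
    AEMeasurable (fun b => ∫⁻ x, f x * ENNReal.ofReal (dens x) ∂F.fiberHaar b)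
      ((riemannianMeasure gB).restrict B₀)
  lintegral_eq : ∀ f : X → ℝ≥0∞, Measurable f →
    ∫⁻ x in F.totalSpace, f x ∂riemannianMeasure g =
      ∫⁻ b in (B₀ : Set B), ENNReal.ofReal (area b) *
        ∫⁻ x, f x * ENNReal.ofReal (dens x) ∂F.fiberHaar b ∂riemannianMeasure gB

namespace NormalizedDisintegration

variable {F : FlatTorusFibration B₀ X} {gB : SmoothMetric 2 B} {g : SmoothMetric 4 X}

/-- `‖ρ - 1‖_{L^∞(X_{t,0})} ≤ δ`. -/
def DensityControl (N : NormalizedDisintegration F gB g) (δ : ℝ) : Prop :=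
  ∀ᵐ x ∂(riemannianMeasure g).restrict F.totalSpace, |N.dens x - 1| ≤ δ

/-- `(I v)(x) = A(Π x)^{-1/2} v(Π x)`. -/
def liftFun (N : NormalizedDisintegration F gB g) (v : B → ℂ) (x : X) : ℂ :=
  ((N.area (F.proj x)) ^ (-(1 / 2) : ℝ) : ℝ) * v (F.proj x)

/-- `(P u)(b) = A(b)^{1/2} ∫_{F_b} u ρ dϑ_b`. -/
def averageFun (N : NormalizedDisintegration F gB g) (u : X → ℂ) (b : B) : ℂ :=
  ((N.area b) ^ (1 / 2 : ℝ) : ℝ) * ∫ x, u x * (N.dens x : ℂ) ∂F.fiberHaar b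

/-- The probability measure `ρ ϑ_b` on the fiber over `b`. -/
def fiberProb (N : NormalizedDisintegration F gB g) (b : B) : Measure X :=
  (F.fiberHaar b).withDensity fun x => ENNReal.ofReal (N.dens x)

lemma lintegral_fiberProb (N : NormalizedDisintegration F gB g) (b : B) {f : X → ℝ≥0∞}
    (hf : Measurable f) :
    ∫⁻ x, f x ∂N.fiberProb b = ∫⁻ x, f x * ENNReal.ofReal (N.dens x) ∂F.fiberHaar b := by
  rw [fiberProb, lintegral_withDensity_eq_lintegral_mul _ N.measurable_dens.ennreal_ofReal hf]
  simp [mul_comm]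

lemma isProbabilityMeasure_fiberProb (N : NormalizedDisintegration F gB g) {b : B} (hb : b ∈ B₀) :
    IsProbabilityMeasure (N.fiberProb b) :=
  ⟨by rw [fiberProb, withDensity_apply _ MeasurableSet.univ, Measure.restrict_univ,
    N.dens_normalized b hb]⟩

lemma ae_fiberHaar_proj_eq [T1Space B] (F : FlatTorusFibration B₀ X) {b : B} (hb : b ∈ B₀) :
    ∀ᵐ x ∂F.fiberHaar b, F.proj x = b := by
  have hm : MeasurableSet {x | F.proj x = b} :=
    (isClosed_singleton.preimage F.contMDiff_proj.continuous).measurableSet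
  rw [FlatTorusFibration.fiberHaar, ae_map_iff
    (F.contMDiff_param b hb).continuous.measurable.aemeasurable hm]
  refine ae_of_all _ fun a => ?_
  have : F.param b a ∈ F.proj ⁻¹' {b} := by
    rw [← F.range_param b hb]; exact mem_range_self a
  exact this

lemma ae_proj_eq [T1Space B] (N : NormalizedDisintegration F gB g) {b : B} (hb : b ∈ B₀) :
    ∀ᵐ x ∂N.fiberProb b, F.proj x = b :=
  (withDensity_absolutelyContinuous _ _).ae_le (ae_fiberHaar_proj_eq F hb)

lemma averageFun_eq [T1Space B] (N : NormalizedDisintegration F gB g) (u : X → ℂ) {b : B}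
    (hb : b ∈ B₀) :
    N.averageFun u b = ((N.area b) ^ (1 / 2 : ℝ) : ℝ) * ∫ x, u x ∂N.fiberProb b := by
  rw [averageFun, fiberProb, integral_withDensity_eq_integral_toReal_smul
    N.measurable_dens.ennreal_ofReal (ae_of_all _ fun _ => ENNReal.ofReal_lt_top)]
  congr 1
  refine integral_congr_ae ?_
  filter_upwards [ae_fiberHaar_proj_eq F hb] with x hx
  have hx0 : x ∈ F.totalSpace := by
    change F.proj x ∈ B₀
    rw [hx]; exact hb
  rw [ENNReal.toReal_ofReal (N.dens_pos x hx0).le, Complex.real_smul, mul_comm]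

lemma lintegral_eq' (N : NormalizedDisintegration F gB g) {f : X → ℝ≥0∞} (hf : Measurable f) :
    ∫⁻ x in F.totalSpace, f x ∂riemannianMeasure g =
      ∫⁻ b in (B₀ : Set B), ENNReal.ofReal (N.area b) *
        ∫⁻ x, f x ∂N.fiberProb b ∂riemannianMeasure gB := by
  rw [N.lintegral_eq f hf]
  simp only [N.lintegral_fiberProb _ hf]

lemma ae_fiberProb (N : NormalizedDisintegration F gB g) {p : X → Prop}
    (hp : ∀ᵐ x ∂(riemannianMeasure g).restrict F.totalSpace, p x) :
    ∀ᵐ b ∂(riemannianMeasure gB).restrict B₀, ∀ᵐ x ∂N.fiberProb b, p x := by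
  obtain ⟨t, ht, htm, ht0⟩ := exists_measurable_superset_of_null (ae_iff.1 hp)
  have h1 := N.lintegral_eq' (f := t.indicator 1) (measurable_one.indicator htm)
  rw [lintegral_indicator_one htm, ht0] at h1
  have hae : AEMeasurable (fun b => ENNReal.ofReal (N.area b) *
      ∫⁻ x, t.indicator 1 x ∂N.fiberProb b) ((riemannianMeasure gB).restrict B₀) := by
    refine N.measurable_area.ennreal_ofReal.aemeasurable.mul ?_
    simp only [N.lintegral_fiberProb _ (measurable_one.indicator htm)]
    exact N.aemeasurable_fiber _ (measurable_one.indicator htm)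
  have h2 := (lintegral_eq_zero_iff' hae).1 h1.symm
  filter_upwards [h2, ae_restrict_mem B₀.isOpen.measurableSet] with b hb hbB
  have h3 : (N.fiberProb b) t = 0 := by
    rw [lintegral_indicator_one htm] at hb
    simpa [not_le.2 (N.area_pos b hbB)] using hb
  exact measure_mono_null ht h3

lemma quasiMeasurePreserving_proj [T1Space B] (N : NormalizedDisintegration F gB g) :
    Measure.QuasiMeasurePreserving F.proj ((riemannianMeasure g).restrict F.totalSpace)
      ((riemannianMeasure gB).restrict B₀) := by
  have hproj := F.contMDiff_proj.continuous.measurable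
  refine ⟨hproj, Measure.AbsolutelyContinuous.mk fun s hs h0 => ?_⟩
  rw [Measure.map_apply hproj hs, ← lintegral_indicator_one (hproj hs),
    N.lintegral_eq' (measurable_one.indicator (hproj hs)), lintegral_eq_zero_of_ae_eq_zero]
  have h1 : ∀ᵐ b ∂(riemannianMeasure gB).restrict B₀, b ∉ s := measure_eq_zero_iff_ae_notMem.1 h0
  filter_upwards [h1, ae_restrict_mem B₀.isOpen.measurableSet] with b hb hbB
  have : ∫⁻ x, (F.proj ⁻¹' s).indicator 1 x ∂N.fiberProb b = 0 := by
    rw [lintegral_eq_zero_of_ae_eq_zero]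
    filter_upwards [N.ae_proj_eq hbB] with x hx
    simp [hx, hb]
  rw [this, mul_zero]; rfl

lemma eLpNorm_two_eq {α : Type*} [MeasurableSpace α] (μ : Measure α) (f : α → ℂ) :
    eLpNorm f 2 μ = (∫⁻ x, ‖f x‖ₑ ^ 2 ∂μ) ^ (1 / 2 : ℝ) := by
  rw [eLpNorm_eq_lintegral_rpow_enorm_toReal (by simp) (by simp)]
  simp

lemma measurable_liftFun (N : NormalizedDisintegration F gB g) {v : B → ℂ}
    (hv : Measurable v) : Measurable (N.liftFun v) := by
  have hproj := F.contMDiff_proj.continuous.measurable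
  exact (Complex.measurable_ofReal.comp ((N.measurable_area.comp hproj).pow_const _)).mul
    (hv.comp hproj)

lemma eLpNorm_liftFun [T1Space B] (N : NormalizedDisintegration F gB g) {v : B → ℂ}
    (hv : Measurable v) :
    eLpNorm (N.liftFun v) 2 ((riemannianMeasure g).restrict F.totalSpace) =
      eLpNorm v 2 ((riemannianMeasure gB).restrict B₀) := by
  rw [eLpNorm_two_eq, eLpNorm_two_eq, N.lintegral_eq' ((N.measurable_liftFun hv).enorm.pow_const 2)]
  congr 1
  refine setLIntegral_congr_fun B₀.isOpen.measurableSet fun b hb => ?_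
  have := N.isProbabilityMeasure_fiberProb hb
  have hpos := N.area_pos b hb
  have h1 : ∫⁻ x, ‖N.liftFun v x‖ₑ ^ 2 ∂N.fiberProb b =
      ∫⁻ _x, (ENNReal.ofReal (N.area b))⁻¹ * ‖v b‖ₑ ^ 2 ∂N.fiberProb b := by
    refine lintegral_congr_ae ?_
    filter_upwards [N.ae_proj_eq hb] with x hx
    rw [liftFun, hx, enorm_mul, mul_pow]
    congr 1
    rw [← ofReal_norm, Complex.norm_real, Real.norm_of_nonneg (by positivity),
      ← ENNReal.ofReal_pow (by positivity), ← ENNReal.ofReal_inv_of_pos hpos,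
      ← Real.rpow_natCast, ← Real.rpow_mul hpos.le]
    norm_num [Real.rpow_neg_one]
  rw [h1, lintegral_const, measure_univ, mul_one, ← mul_assoc, ENNReal.mul_inv_cancel, one_mul]
  · simpa using hpos
  · simp

lemma ae_memLp_fiber (N : NormalizedDisintegration F gB g) {u : X → ℂ}
    (hu : Measurable u) (hu2 : MemLp u 2 ((riemannianMeasure g).restrict F.totalSpace)) :
    ∀ᵐ b ∂(riemannianMeasure gB).restrict B₀, MemLp u 2 (N.fiberProb b) := by
  have hm : Measurable fun x => ‖u x‖ₑ ^ 2 := hu.enorm.pow_const 2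
  have h1 : ∫⁻ x in F.totalSpace, ‖u x‖ₑ ^ 2 ∂riemannianMeasure g ≠ ⊤ := by
    have := hu2.2
    rw [eLpNorm_two_eq] at this
    intro h
    simp [h] at this
  rw [N.lintegral_eq' hm] at h1
  have hae : AEMeasurable (fun b => ENNReal.ofReal (N.area b) *
      ∫⁻ x, ‖u x‖ₑ ^ 2 ∂N.fiberProb b) ((riemannianMeasure gB).restrict B₀) := by
    refine N.measurable_area.ennreal_ofReal.aemeasurable.mul ?_
    simp only [N.lintegral_fiberProb _ hm]
    exact N.aemeasurable_fiber _ hm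
  filter_upwards [ae_lt_top' hae h1, ae_restrict_mem B₀.isOpen.measurableSet] with b hb hbB
  refine ⟨hu.aestronglyMeasurable, ?_⟩
  rw [eLpNorm_two_eq]
  refine ENNReal.rpow_lt_top_of_nonneg (by norm_num) fun h => ?_
  rw [h, ENNReal.mul_top (by simpa using N.area_pos b hbB)] at hb
  exact lt_irrefl _ hb

lemma aestronglyMeasurable_averageFun [T1Space B] (N : NormalizedDisintegration F gB g)
    {u : X → ℂ} (hu : Measurable u)
    (hu2 : MemLp u 2 ((riemannianMeasure g).restrict F.totalSpace)) :
    AEStronglyMeasurable (N.averageFun u) ((riemannianMeasure gB).restrict B₀) := by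
  have hI : ∀ w : X → ℝ, Measurable w → AEMeasurable
      (fun b => (∫⁻ x, ENNReal.ofReal (w x) ∂N.fiberProb b).toReal)
      ((riemannianMeasure gB).restrict B₀) := by
    intro w hw
    refine AEMeasurable.ennreal_toReal ?_
    simp only [N.lintegral_fiberProb _ hw.ennreal_ofReal]
    exact N.aemeasurable_fiber _ hw.ennreal_ofReal
  have hre : Measurable fun x => (u x).re := Complex.measurable_re.comp hu
  have him : Measurable fun x => (u x).im := Complex.measurable_im.comp hu
  have hR := (hI _ hre).sub (hI _ hre.neg)
  have hJ := (hI _ him).sub (hI _ him.neg)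
  have hS : AEMeasurable (fun b => (((N.area b) ^ (1 / 2 : ℝ) : ℝ) : ℂ) *
      ((((∫⁻ x, ENNReal.ofReal (u x).re ∂N.fiberProb b).toReal -
        (∫⁻ x, ENNReal.ofReal (-(u x).re) ∂N.fiberProb b).toReal : ℝ) : ℂ) +
      (((∫⁻ x, ENNReal.ofReal (u x).im ∂N.fiberProb b).toReal -
        (∫⁻ x, ENNReal.ofReal (-(u x).im) ∂N.fiberProb b).toReal : ℝ) : ℂ) * Complex.I))
      ((riemannianMeasure gB).restrict B₀) := by
    refine (Complex.measurable_ofReal.comp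
      (N.measurable_area.pow_const _)).aemeasurable.mul ?_
    exact (Complex.measurable_ofReal.comp_aemeasurable hR).add
      ((Complex.measurable_ofReal.comp_aemeasurable hJ).mul_const _)
  refine (hS.congr ?_).aestronglyMeasurable
  filter_upwards [N.ae_memLp_fiber hu hu2, ae_restrict_mem B₀.isOpen.measurableSet] with b hb hbB
  have := N.isProbabilityMeasure_fiberProb hbB
  have hint : Integrable u (N.fiberProb b) := hb.integrable (by norm_num)
  rw [N.averageFun_eq u hbB]
  congr 1
  have h1 := integral_eq_lintegral_pos_part_sub_lintegral_neg_part hint.re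
  have h2 := integral_eq_lintegral_pos_part_sub_lintegral_neg_part hint.im
  refine Eq.trans ?_ (integral_re_add_im hint)
  rw [h1, h2]
  rfl

lemma eLpNorm_averageFun_le [T1Space B] (N : NormalizedDisintegration F gB g) {u : X → ℂ}
    (hu : Measurable u) :
    eLpNorm (N.averageFun u) 2 ((riemannianMeasure gB).restrict B₀) ≤
      eLpNorm u 2 ((riemannianMeasure g).restrict F.totalSpace) := by
  rw [eLpNorm_two_eq, eLpNorm_two_eq, N.lintegral_eq' (hu.enorm.pow_const 2)]
  refine ENNReal.rpow_le_rpow ?_ (by norm_num)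
  refine setLIntegral_mono' B₀.isOpen.measurableSet fun b hb => ?_
  have := N.isProbabilityMeasure_fiberProb hb
  have hpos := N.area_pos b hb
  rw [N.averageFun_eq u hb, enorm_mul, mul_pow]
  gcongr
  · rw [← ofReal_norm, Complex.norm_real, Real.norm_of_nonneg (by positivity),
      ← ENNReal.ofReal_pow (by positivity), ← Real.rpow_natCast, ← Real.rpow_mul hpos.le]
    norm_num
  · have h1 : ‖∫ x, u x ∂N.fiberProb b‖ₑ ≤ eLpNorm u 2 (N.fiberProb b) := by
      refine (enorm_integral_le_lintegral_enorm _).trans ?_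
      rw [← eLpNorm_one_eq_lintegral_enorm]
      exact eLpNorm_le_eLpNorm_of_exponent_le (by norm_num) hu.aestronglyMeasurable
    calc _ ≤ (eLpNorm u 2 (N.fiberProb b)) ^ 2 := by gcongr
      _ = _ := by
        rw [eLpNorm_two_eq, ← ENNReal.rpow_natCast, ← ENNReal.rpow_mul]
        norm_num

lemma memLp_liftFun [T1Space B] (N : NormalizedDisintegration F gB g)
    (v : Lp ℂ 2 ((riemannianMeasure gB).restrict B₀)) :
    MemLp (N.liftFun v) 2 ((riemannianMeasure g).restrict F.totalSpace) :=
  ⟨(N.measurable_liftFun (Lp.stronglyMeasurable v).measurable).aestronglyMeasurable,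
    (N.eLpNorm_liftFun (Lp.stronglyMeasurable v).measurable).trans_lt (Lp.memLp v).2⟩

lemma memLp_averageFun [T1Space B] (N : NormalizedDisintegration F gB g)
    (u : Lp ℂ 2 ((riemannianMeasure g).restrict F.totalSpace)) :
    MemLp (N.averageFun u) 2 ((riemannianMeasure gB).restrict B₀) :=
  ⟨N.aestronglyMeasurable_averageFun (Lp.stronglyMeasurable u).measurable (Lp.memLp u),
    (N.eLpNorm_averageFun_le (Lp.stronglyMeasurable u).measurable).trans_lt (Lp.memLp u).2⟩

lemma liftFun_add_ae [T1Space B] (N : NormalizedDisintegration F gB g)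
    (v w : Lp ℂ 2 ((riemannianMeasure gB).restrict B₀)) :
    N.liftFun (v + w : Lp ℂ 2 ((riemannianMeasure gB).restrict B₀))
      =ᵐ[(riemannianMeasure g).restrict F.totalSpace] N.liftFun v + N.liftFun w := by
  filter_upwards [N.quasiMeasurePreserving_proj.ae (Lp.coeFn_add v w)] with x hx
  simp only [liftFun, Pi.add_apply, hx, mul_add]

lemma liftFun_smul_ae [T1Space B] (N : NormalizedDisintegration F gB g)
    (c : ℂ) (v : Lp ℂ 2 ((riemannianMeasure gB).restrict B₀)) :
    N.liftFun (c • v : Lp ℂ 2 ((riemannianMeasure gB).restrict B₀))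
      =ᵐ[(riemannianMeasure g).restrict F.totalSpace] c • N.liftFun v := by
  filter_upwards [N.quasiMeasurePreserving_proj.ae (Lp.coeFn_smul c v)] with x hx
  simp only [liftFun, Pi.smul_apply, hx, smul_eq_mul]
  ring

lemma averageFun_add_ae [T1Space B] (N : NormalizedDisintegration F gB g)
    (u w : Lp ℂ 2 ((riemannianMeasure g).restrict F.totalSpace)) :
    N.averageFun (u + w : Lp ℂ 2 ((riemannianMeasure g).restrict F.totalSpace))
      =ᵐ[(riemannianMeasure gB).restrict B₀] N.averageFun u + N.averageFun w := by
  filter_upwards [N.ae_fiberProb (Lp.coeFn_add u w),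
    N.ae_memLp_fiber (Lp.stronglyMeasurable u).measurable (Lp.memLp u),
    N.ae_memLp_fiber (Lp.stronglyMeasurable w).measurable (Lp.memLp w),
    ae_restrict_mem B₀.isOpen.measurableSet] with b hb hub hwb hbB
  have := N.isProbabilityMeasure_fiberProb hbB
  rw [Pi.add_apply, N.averageFun_eq _ hbB, N.averageFun_eq _ hbB, N.averageFun_eq _ hbB,
    ← mul_add, ← integral_add (hub.integrable (by norm_num)) (hwb.integrable (by norm_num))]
  congr 1
  exact integral_congr_ae hb

lemma averageFun_smul_ae [T1Space B] (N : NormalizedDisintegration F gB g)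
    (c : ℂ) (u : Lp ℂ 2 ((riemannianMeasure g).restrict F.totalSpace)) :
    N.averageFun (c • u : Lp ℂ 2 ((riemannianMeasure g).restrict F.totalSpace))
      =ᵐ[(riemannianMeasure gB).restrict B₀] c • N.averageFun u := by
  filter_upwards [N.ae_fiberProb (Lp.coeFn_smul c u),
    ae_restrict_mem B₀.isOpen.measurableSet] with b hb hbB
  have h : ∫ x, (c • u : Lp ℂ 2 ((riemannianMeasure g).restrict F.totalSpace)) x ∂N.fiberProb b =
      c * ∫ x, u x ∂N.fiberProb b := (integral_congr_ae hb).trans (integral_const_mul _ _)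
  rw [Pi.smul_apply, N.averageFun_eq _ hbB, N.averageFun_eq _ hbB, smul_eq_mul, h]
  ring

/-- The normalized lift `I : L²(B₀, μ_B) → L²(X_{t,0}, μ_t)`. -/
def lift [T1Space B] (N : NormalizedDisintegration F gB g) :
    Lp ℂ 2 ((riemannianMeasure gB).restrict B₀) →L[ℂ]
      Lp ℂ 2 ((riemannianMeasure g).restrict F.totalSpace) :=
  LinearMap.mkContinuous
    { toFun := fun v => (N.memLp_liftFun v).toLp (N.liftFun v)
      map_add' := fun v w =>
        (MemLp.toLp_congr (N.memLp_liftFun (v + w)) ((N.memLp_liftFun v).add (N.memLp_liftFun w))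
          (N.liftFun_add_ae v w)).trans (MemLp.toLp_add _ _)
      map_smul' := fun c v =>
        (MemLp.toLp_congr (N.memLp_liftFun (c • v)) ((N.memLp_liftFun v).const_smul c)
          (N.liftFun_smul_ae c v)).trans (MemLp.toLp_const_smul _ _) } 1 fun v => by
    rw [one_mul, Lp.norm_def v]
    refine (Lp.norm_toLp _ (N.memLp_liftFun v)).trans_le ?_
    rw [N.eLpNorm_liftFun (Lp.stronglyMeasurable v).measurable]

/-- The normalized fiber average `P : L²(X_{t,0}, μ_t) → L²(B₀, μ_B)`. -/
def average [T1Space B] (N : NormalizedDisintegration F gB g) :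
    Lp ℂ 2 ((riemannianMeasure g).restrict F.totalSpace) →L[ℂ]
      Lp ℂ 2 ((riemannianMeasure gB).restrict B₀) :=
  LinearMap.mkContinuous
    { toFun := fun u => (N.memLp_averageFun u).toLp (N.averageFun u)
      map_add' := fun u w =>
        (MemLp.toLp_congr (N.memLp_averageFun (u + w))
          ((N.memLp_averageFun u).add (N.memLp_averageFun w))
          (N.averageFun_add_ae u w)).trans (MemLp.toLp_add _ _)
      map_smul' := fun c u =>
        (MemLp.toLp_congr (N.memLp_averageFun (c • u)) ((N.memLp_averageFun u).const_smul c)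
          (N.averageFun_smul_ae c u)).trans (MemLp.toLp_const_smul _ _) } 1 fun u => by
    rw [one_mul, Lp.norm_def u]
    refine (Lp.norm_toLp _ (N.memLp_averageFun u)).trans_le ?_
    exact ENNReal.toReal_mono (Lp.memLp u).2.ne
      (N.eLpNorm_averageFun_le (Lp.stronglyMeasurable u).measurable)

/-- The compressed heat operator `S(τ) = P e^{-τ H} I` on `L²(B₀, μ_B)`. -/
def compressedHeat [T1Space B] (N : NormalizedDisintegration F gB g) (τ : ℝ) :
    Lp ℂ 2 ((riemannianMeasure gB).restrict B₀) →L[ℂ]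
      Lp ℂ 2 ((riemannianMeasure gB).restrict B₀) :=
  N.average ∘L dirichletHeat g F.totalSpace τ ∘L N.lift

end NormalizedDisintegration

end Fibration

end SemiFlat

end

open SemiFlat

/-! Write `T` for the heat semigroup, `I` for the lift and `P` for the fiber average. Since `T(τ+σ)
= T(τ)T(σ)`, the defect of the compressed semigroup is `S(τ)S(σ) - S(τ+σ) = -P T(τ) (1 - I P) T(σ)
I`. The operators `P`, `T(τ)` and `I` are contractions, so everything reduces to the norm of `(1 - I
P) T(σ)`: the heat flow at time `σ` must leave little deviation from the fiber average.

Two inequalities give this. The first is spatial: for a test function `u` with Dirichlet energy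
`E(u)`, `‖(1 - I P) u‖² ≤ κ E(u)` with `κ` of order `s(t)²` (`norm_fluctuation_sq_le`). On one fiber
it is the Poincaré inequality of a flat torus, with constant `1/λ₁`. The semi-flat control bounds
the derivative along the fiber by the full gradient, and the closeness of `ρ` to `1` allows passage
between Haar measure and `ρ ϑ_b`. The disintegration then integrates the fiber inequalities over the
base. Fibers over `B₀` are closed tori inside the domain, so the boundary condition plays no role
here.

The second is temporal: `E(T(σ) f) ≤ ‖f‖² / (2σ)`, because `l e^{-2σl} ≤ 1/(2σ)` for `l ≥ 0`
(`exists_formHeat_eq_formInclusion`). As the heat operator is defined through the bounded operator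
`R = J J^* = (1 + H)⁻¹`, the energy of a vector `v` of the form domain appears as `‖v‖² - ‖J v‖²`,
and no unbounded operator is needed. Combining the two gives a defect of at most `√(κ / (2σ))`, of
order `s(t) / √σ`.

The Poincaré inequality (`torusLambdaOne_mul_integral_le`) comes from Parseval's identity. Because
`λ₁` is an infimum, it suffices to know that every nonconstant character has an eigenvalue that
competes in it (`torusLambdaOne_le`); that the characters exhaust the spectrum is not needed. -/

namespace SemiFlat

set_option linter.unusedSectionVars false

/-! ### Smoothing by the heat operator of a closed form, by functional calculus in `(1 + H)⁻¹`. -/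

section HeatSmoothing

variable {V H H' : Type*} [SeminormedAddCommGroup V] [InnerProductSpace ℂ V]
  [NormedAddCommGroup H] [InnerProductSpace ℂ H] [CompleteSpace H]
  [NormedAddCommGroup H'] [InnerProductSpace ℂ H']

lemma heatProfile_mul (τ σ x : ℝ) :
    heatProfile τ x * heatProfile σ x = heatProfile (τ + σ) x := by
  unfold heatProfile
  split_ifs
  · rw [← Real.exp_add]
    congr 1
    ring
  · simp

lemma heatProfile_nonneg (τ x : ℝ) : 0 ≤ heatProfile τ x := by
  unfold heatProfile
  split_ifs <;> positivity

lemma heatProfile_le_one {τ x : ℝ} (hτ : 0 < τ) (hx : x ≤ 1) : heatProfile τ x ≤ 1 := by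
  unfold heatProfile
  split_ifs with h
  · have : 1 ≤ x⁻¹ := (one_le_inv₀ h).2 hx
    rw [Real.exp_le_one_iff]
    nlinarith
  · exact zero_le_one

/-- The functional calculus is multiplicative and the profiles satisfy the exponential law
pointwise. Positive times are needed because the profile is continuous at `0` only for them. -/
lemma formHeat_comp (ι : V →L[ℂ] H) {τ σ : ℝ} (hτ : 0 < τ) (hσ : 0 < σ) :
    formHeat ι τ ∘L formHeat ι σ = formHeat ι (τ + σ) := by
  have h := cfc_mul (p := IsSelfAdjoint) (heatProfile τ) (heatProfile σ) (formResolvent ι)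
    (continuous_heatProfile hτ).continuousOn (continuous_heatProfile hσ).continuousOn
  simp only [heatProfile_mul] at h
  exact h.symm

lemma norm_formInclusion_le {ι : V →L[ℂ] H} (hι : ∀ v, ‖ι v‖ ≤ ‖v‖) : ‖formInclusion ι‖ ≤ 1 := by
  refine ContinuousLinearMap.opNorm_le_bound _ zero_le_one fun v => ?_
  rw [one_mul]
  induction v using UniformSpace.Completion.induction_on with
  | hp => exact isClosed_le (formInclusion ι).continuous.norm continuous_norm
  | ih v => rw [formInclusion_coe, UniformSpace.Completion.norm_coe]; exact hι v

lemma norm_formResolvent_le {ι : V →L[ℂ] H} (hι : ∀ v, ‖ι v‖ ≤ ‖v‖) : ‖formResolvent ι‖ ≤ 1 := by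
  refine (ContinuousLinearMap.opNorm_comp_le _ _).trans ?_
  rw [LinearIsometryEquiv.norm_map]
  exact mul_le_one₀ (norm_formInclusion_le hι) (norm_nonneg _) (norm_formInclusion_le hι)

/-- Only the upper end of the spectrum matters: to the left of `0` the heat profile vanishes, so no
lower bound is required. -/
lemma le_one_of_mem_spectrum_formResolvent {ι : V →L[ℂ] H} (hι : ∀ v, ‖ι v‖ ≤ ‖v‖) {x : ℝ}
    (hx : x ∈ spectrum ℝ (formResolvent ι)) : x ≤ 1 := by
  refine (le_abs_self x).trans ((spectrum.norm_le_norm_mul_of_mem hx).trans ?_)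
  exact mul_le_one₀ (norm_formResolvent_le hι) (norm_nonneg _) ContinuousLinearMap.norm_id_le

lemma norm_formHeat_le {ι : V →L[ℂ] H} (hι : ∀ v, ‖ι v‖ ≤ ‖v‖) {τ : ℝ} (hτ : 0 < τ) :
    ‖formHeat ι τ‖ ≤ 1 := by
  refine norm_cfc_le zero_le_one fun x hx => ?_
  rw [Real.norm_of_nonneg (heatProfile_nonneg _ _)]
  exact heatProfile_le_one hτ (le_one_of_mem_spectrum_formResolvent hι hx)

/-- The exponential decay of the profile at `0+` beats the pole of `x⁻¹`. Continuity makes `K =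
k(R)` available in the functional calculus, and hence the factorization `e^{-τH} = R K = J (J^* K)`
through the form domain. -/
lemma continuous_heatProfile_mul_inv {τ : ℝ} (hτ : 0 < τ) :
    Continuous fun x => heatProfile τ x * x⁻¹ := by
  have h : (fun x => heatProfile τ x * x⁻¹) = fun x => Real.exp τ * τ⁻¹ *
      (fun y => (Polynomial.X : Polynomial ℝ).eval y⁻¹ * expNegInvGlue y) (x / τ) := by
    ext x
    unfold heatProfile expNegInvGlue
    by_cases hx : 0 < x
    · have hxτ : ¬ x / τ ≤ 0 := not_le.2 (by positivity)
      simp only [if_pos hx, if_neg hxτ, Polynomial.eval_X]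
      have : Real.exp (-τ * (x⁻¹ - 1)) = Real.exp τ * Real.exp (-(x / τ)⁻¹) := by
        rw [← Real.exp_add]
        congr 1
        field_simp
        ring
      rw [this]
      field_simp
    · simp [hx, div_nonpos_of_nonpos_of_nonneg (not_lt.1 hx) hτ.le]
  rw [h]
  exact continuous_const.mul ((expNegInvGlue.continuous_polynomial_eval_inv_mul _).comp
    (continuous_id.div_const τ))

/-- The spectral function `l e^{-2τl}` of `H e^{-2τH}`, with `x = 1/(1+l)`, is at most `1/(2τ)`. -/
lemma heatProfile_energy_le {τ x : ℝ} (hτ : 0 < τ) (hx : x ≤ 1) :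
    ‖(heatProfile τ x * x⁻¹) * (x - x * x) * (heatProfile τ x * x⁻¹)‖ ≤ (2 * τ)⁻¹ := by
  by_cases h : 0 < x
  · have h1 : 1 ≤ x⁻¹ := (one_le_inv₀ h).2 hx
    have h2 : (heatProfile τ x * x⁻¹) * (x - x * x) * (heatProfile τ x * x⁻¹) =
        (x⁻¹ - 1) * Real.exp (-(2 * τ) * (x⁻¹ - 1)) := by
      have : heatProfile τ x * heatProfile τ x = Real.exp (-(2 * τ) * (x⁻¹ - 1)) := by
        rw [heatProfile_mul, heatProfile, if_pos h, two_mul]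
      rw [← this]
      field_simp
    have h3 : 0 ≤ x⁻¹ - 1 := sub_nonneg.2 h1
    rw [h2, Real.norm_of_nonneg (by positivity), neg_mul, Real.exp_neg,
      ← div_eq_mul_inv, div_le_iff₀ (Real.exp_pos _)]
    -- With `l = x⁻¹ - 1`, the bound `y ≤ e^y` at `y = 2τl` is all that is used.
    have h4 := Real.add_one_le_exp (2 * τ * (x⁻¹ - 1))
    rw [← div_eq_inv_mul, le_div_iff₀ (by positivity)]
    linarith
  · simp [heatProfile, h]
    positivity

/-- The smoothing property of the heat operator: `e^{-τH} f` is in the form domain, with energy at most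
`‖f‖² / (2τ)`. -/
lemma exists_formHeat_eq_formInclusion {ι : V →L[ℂ] H} (hι : ∀ v, ‖ι v‖ ≤ ‖v‖) {τ : ℝ}
    (hτ : 0 < τ) (f : H) :
    ∃ v, formInclusion ι v = formHeat ι τ f ∧
      ‖v‖ ^ 2 - ‖formInclusion ι v‖ ^ 2 ≤ (2 * τ)⁻¹ * ‖f‖ ^ 2 := by
  set J := formInclusion ι
  set R := formResolvent ι with hR
  have hRsa : IsSelfAdjoint R := isSelfAdjoint_formResolvent ι
  set k : ℝ → ℝ := fun x => heatProfile τ x * x⁻¹ with hk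
  have hkc : Continuous k := continuous_heatProfile_mul_inv hτ
  set K : H →L[ℂ] H := cfc (p := IsSelfAdjoint) k R with hK
  have hKsa : IsSelfAdjoint K := cfc_predicate k R
  have hRapply : ∀ h, R h = J (ContinuousLinearMap.adjoint J h) := fun h => rfl
  have hfac : formHeat ι τ = R * K := by
    have h1 := cfc_mul (p := IsSelfAdjoint) (fun x : ℝ => x) k R continuous_id.continuousOn
      hkc.continuousOn
    rw [cfc_id' ℝ R] at h1
    rw [← h1, formHeat]
    refine cfc_congr fun x _ => ?_
    -- Cancelling `x` against `x⁻¹` is also correct at `x = 0`, because the profile vanishes there.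
    by_cases hx : x = 0
    · simp [hk, hx, heatProfile]
    · simp only [hk]
      field_simp
  have hq : cfc (p := IsSelfAdjoint) (fun x => k x * (x - x * x) * k x) R =
      K * (R - R * R) * K := by
    rw [cfc_mul (fun x => k x * (x - x * x)) k R (by fun_prop) (by fun_prop),
      cfc_mul k (fun x : ℝ => x - x * x) R (by fun_prop) (by fun_prop),
      cfc_sub (fun x : ℝ => x) (fun x => x * x) R (by fun_prop) (by fun_prop),
      cfc_mul (fun x : ℝ => x) (fun x => x) R (by fun_prop) (by fun_prop), cfc_id' ℝ R]
  have hqn : ‖K * (R - R * R) * K‖ ≤ (2 * τ)⁻¹ := by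
    rw [← hq]
    refine norm_cfc_le (by positivity) fun x hx => ?_
    exact heatProfile_energy_le hτ (le_one_of_mem_spectrum_formResolvent hι hx)
  have hsymm : ∀ (A : H →L[ℂ] H), IsSelfAdjoint A → ∀ a b, inner ℂ (A a) b = inner ℂ a (A b) :=
    fun A hA => hA.isSymmetric
  -- The witness is `v = J^* K f`, so `J v = R K f = e^{-τH} f`. Its energy is `⟨K f, R K f⟩ - ‖R K
  -- f‖² = ⟨f, K (R - R²) K f⟩`, whose spectral function is `l e^{-2τl}`.
  refine ⟨ContinuousLinearMap.adjoint J (K f), ?_, ?_⟩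
  · rw [hfac]; rfl
  · have h1 : ‖ContinuousLinearMap.adjoint J (K f)‖ ^ 2 =
        RCLike.re (inner ℂ f (K (R (K f)))) := by
      rw [← inner_self_eq_norm_sq (𝕜 := ℂ), ContinuousLinearMap.adjoint_inner_left, ← hRapply,
        hsymm K hKsa]
    have h2 : ‖J (ContinuousLinearMap.adjoint J (K f))‖ ^ 2 =
        RCLike.re (inner ℂ f (K (R (R (K f))))) := by
      rw [← hRapply, ← inner_self_eq_norm_sq (𝕜 := ℂ), hsymm R hRsa, hsymm K hKsa]
    have h3 : (K * (R - R * R) * K) f = K (R (K f)) - K (R (R (K f))) := by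
      change K ((R - R * R) (K f)) = _
      rw [sub_apply, map_sub]
      rfl
    rw [h1, h2, ← map_sub, ← inner_sub_right, ← h3]
    refine (RCLike.re_le_norm _).trans ((norm_inner_le_norm _ _).trans ?_)
    have h4 := (K * (R - R * R) * K).le_of_opNorm_le hqn f
    nlinarith [norm_nonneg f]

/-- An operator that is bounded by the energy on the form core is small after the heat operator. -/
lemma norm_comp_formHeat_le {ι : V →L[ℂ] H} (hι : ∀ v, ‖ι v‖ ≤ ‖v‖) (D : H →L[ℂ] H') {κ : ℝ}
    (hκ : 0 ≤ κ) (hD : ∀ v, ‖D (ι v)‖ ^ 2 ≤ κ * (‖v‖ ^ 2 - ‖ι v‖ ^ 2)) {τ : ℝ} (hτ : 0 < τ) :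
    ‖D ∘L formHeat ι τ‖ ≤ √(κ * (2 * τ)⁻¹) := by
  -- Both sides are continuous for the form norm, so the hypothesis passes from the core to its
  -- completion, where the vector supplied by the smoothing property lives.
  have hext : ∀ v, ‖D (formInclusion ι v)‖ ^ 2 ≤ κ * (‖v‖ ^ 2 - ‖formInclusion ι v‖ ^ 2) := by
    intro v
    induction v using UniformSpace.Completion.induction_on with
    | hp => exact isClosed_le (by fun_prop) (by fun_prop)
    | ih v => rw [formInclusion_coe, UniformSpace.Completion.norm_coe]; exact hD v
  refine ContinuousLinearMap.opNorm_le_bound _ (Real.sqrt_nonneg _) fun f => ?_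
  obtain ⟨v, hv, hle⟩ := exists_formHeat_eq_formInclusion hι hτ f
  rw [ContinuousLinearMap.comp_apply, ← hv]
  refine abs_le_of_sq_le_sq' ?_ (by positivity) |>.2
  rw [mul_pow, Real.sq_sqrt (by positivity), mul_assoc]
  exact (hext v).trans (mul_le_mul_of_nonneg_left hle hκ)

end HeatSmoothing

/-! ### Fourier analysis on a flat torus `ℝᵈ / Λ`, transported from the standard torus. -/

section FlatTorus

variable {d : ℕ} (L : Module.Basis (Fin d) ℝ (EucSpace d))

/-- The uniform probability measure on the fundamental domain of the lattice with basis `L`. -/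
noncomputable abbrev latticeProb : Measure (EucSpace d) :=
  ProbabilityTheory.cond volume (ZSpan.fundamentalDomain L)

/-- Functions on the torus `ℝᵈ / Λ`, as `Λ`-periodic functions on `ℝᵈ`. -/
def LatticePeriodic {α : Type*} (f : EucSpace d → α) : Prop :=
  ∀ z ∈ Submodule.span ℤ (range L), ∀ x, f (x + z) = f x

/-- The Haar probability measure of the standard torus. -/
noncomputable abbrev torusHaar (d : ℕ) : Measure (UnitAddTorus (Fin d)) :=
  Measure.pi fun _ => AddCircle.haarAddCircle

/-- The covering of the standard torus with kernel `Λ`. -/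
noncomputable def toTorus (x : EucSpace d) : UnitAddTorus (Fin d) := fun i => (L.repr x i : UnitAddCircle)

lemma toTorus_add (x y : EucSpace d) : toTorus L (x + y) = toTorus L x + toTorus L y := by
  ext i
  simp [toTorus]

lemma volume_fundamentalDomain_ne_zero : volume (ZSpan.fundamentalDomain L) ≠ 0 :=
  ZSpan.measure_fundamentalDomain_ne_zero L

lemma volume_fundamentalDomain_ne_top : volume (ZSpan.fundamentalDomain L) ≠ ⊤ :=
  (ZSpan.fundamentalDomain_isBounded L).measure_lt_top.ne

instance isProbabilityMeasure_latticeProb : IsProbabilityMeasure (latticeProb L) :=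
  ProbabilityTheory.cond_isProbabilityMeasure_of_finite (volume_fundamentalDomain_ne_zero L)
    (volume_fundamentalDomain_ne_top L)

/-- Lattice coordinates carry the fundamental domain to the unit cube and Lebesgue measure to a
multiple `c` of Lebesgue measure. The cube has volume one, so `c` is the covolume and conditioning
cancels it. -/
lemma map_equivFun_latticeProb :
    (latticeProb L).map L.equivFun = Measure.pi fun _ => volume.restrict (Ico (0 : ℝ) 1) := by
  set e : EucSpace d ≃L[ℝ] (Fin d → ℝ) := L.equivFun.toContinuousLinearEquiv with he
  have hmeas : Measurable L.equivFun := e.continuous.measurable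
  have hFD : ZSpan.fundamentalDomain L = L.equivFun ⁻¹' univ.pi fun _ => Ico (0 : ℝ) 1 := by
    ext x
    simp [ZSpan.mem_fundamentalDomain, Module.Basis.equivFun_apply]
  have hbox : MeasurableSet (univ.pi fun _ : Fin d => Ico (0 : ℝ) 1) :=
    MeasurableSet.univ_pi fun _ => measurableSet_Ico
  have hhaar : (volume.map L.equivFun : Measure (Fin d → ℝ)).IsAddHaarMeasure :=
    e.isAddHaarMeasure_map volume
  have hc := Measure.isAddLeftInvariant_eq_smul (volume.map L.equivFun : Measure (Fin d → ℝ)) volume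
  set c := Measure.addHaarScalarFactor (volume.map L.equivFun : Measure (Fin d → ℝ)) volume
  have hvol : volume (ZSpan.fundamentalDomain L) = (c : ℝ≥0∞) := by
    rw [hFD, ← Measure.map_apply hmeas hbox, hc, Measure.smul_apply, volume_pi_pi]
    simp [ENNReal.smul_def]
  have h0 : (c : ℝ≥0∞) ≠ 0 := hvol ▸ volume_fundamentalDomain_ne_zero L
  rw [latticeProb, ProbabilityTheory.cond, Measure.map_smul, hvol, hFD,
    ← Measure.restrict_map hmeas hbox, hc, Measure.restrict_smul, ← Measure.restrict_pi_pi,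
    ← volume_pi, ENNReal.smul_def, smul_smul, ENNReal.inv_mul_cancel h0 ENNReal.coe_ne_top, one_smul]

/-- This is the bridge by which translation invariance and Parseval's identity are pulled back from
the standard torus to an arbitrary lattice. -/
lemma measurePreserving_toTorus : MeasurePreserving (toTorus L) (latticeProb L) (torusHaar d) := by
  have h1 : MeasurePreserving L.equivFun (latticeProb L)
      (Measure.pi fun _ => volume.restrict (Ico (0 : ℝ) 1)) :=
    ⟨L.equivFun.toContinuousLinearEquiv.continuous.measurable, map_equivFun_latticeProb L⟩
  have h2 : MeasurePreserving ((↑) : ℝ → UnitAddCircle) (volume.restrict (Ico (0 : ℝ) 1))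
      AddCircle.haarAddCircle := by
    have h := UnitAddCircle.measurePreserving_mk 0
    rw [AddCircle.volume_eq_smul_haarAddCircle, ENNReal.ofReal_one, one_smul, zero_add] at h
    rwa [Measure.restrict_congr_set Ico_ae_eq_Ioc]
  exact (measurePreserving_pi _ _ fun _ : Fin d => h2).comp h1

variable {L}

/-- The function on the standard torus that corresponds to a periodic function. -/
noncomputable def periodicLift {α : Type*} (L : Module.Basis (Fin d) ℝ (EucSpace d))
    (f : EucSpace d → α) (y : UnitAddTorus (Fin d)) : α :=
  f (L.equivFun.symm fun i => (AddCircle.equivIco 1 0 (y i)).1)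

lemma LatticePeriodic.fract {α : Type*} {f : EucSpace d → α} (hf : LatticePeriodic L f)
    (x : EucSpace d) : f (ZSpan.fract L x) = f x := by
  have h := hf _ (-ZSpan.floor L x).2 x
  rwa [Submodule.coe_neg, ← sub_eq_add_neg, ← ZSpan.fract_apply] at h

/-- The lift evaluates `f` at the representative in the fundamental domain, which is `ZSpan.fract L
x`; periodicity removes the difference from `x`. -/
lemma periodicLift_toTorus {α : Type*} {f : EucSpace d → α} (hf : LatticePeriodic L f)
    (x : EucSpace d) : periodicLift L f (toTorus L x) = f x := by
  rw [periodicLift, ← hf.fract x]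
  congr 1
  rw [LinearEquiv.symm_apply_eq]
  ext i
  rw [Module.Basis.equivFun_apply, ZSpan.repr_fract_apply, toTorus,
    AddCircle.coe_equivIco_mk_apply]
  simp

lemma measurable_periodicLift {α : Type*} [MeasurableSpace α] {f : EucSpace d → α}
    (hf : Measurable f) : Measurable (periodicLift L f) := by
  refine hf.comp (L.equivFun.symm.toContinuousLinearEquiv.continuous.measurable.comp ?_)
  refine measurable_pi_lambda _ fun i => ?_
  exact (measurable_subtype_coe.comp (AddCircle.measurableEquivIco 1 0).measurable).comp
    (measurable_pi_apply i)

/-- Every value is already attained on the fundamental domain, which has compact closure. This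
supplies the integrability and domination needed below. -/
lemma LatticePeriodic.exists_norm_le {E : Type*} [NormedAddCommGroup E] {f : EucSpace d → E}
    (hf : LatticePeriodic L f) (hc : Continuous f) : ∃ C, ∀ x, ‖f x‖ ≤ C := by
  obtain ⟨C, hC⟩ := (ZSpan.fundamentalDomain_isBounded L).isCompact_closure.exists_bound_of_continuousOn
    hc.continuousOn
  refine ⟨C, fun x => ?_⟩
  rw [← hf.fract x]
  exact hC _ (subset_closure (ZSpan.fract_mem_fundamentalDomain L x))

lemma LatticePeriodic.memLp {E : Type*} [NormedAddCommGroup E] {f : EucSpace d → E}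
    (hf : LatticePeriodic L f) (hc : Continuous f) (p : ℝ≥0∞) : MemLp f p (latticeProb L) := by
  obtain ⟨C, hC⟩ := hf.exists_norm_le hc
  exact MemLp.of_bound hc.aestronglyMeasurable C (ae_of_all _ hC)

lemma LatticePeriodic.integral_periodicLift {f : EucSpace d → ℂ} (hf : LatticePeriodic L f)
    (hc : Continuous f) : ∫ y, periodicLift L f y ∂torusHaar d = ∫ x, f x ∂latticeProb L := by
  rw [← (measurePreserving_toTorus L).map_eq, integral_map
    (measurePreserving_toTorus L).measurable.aemeasurable
    (measurable_periodicLift hc.measurable).aestronglyMeasurable]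
  simp only [periodicLift_toTorus hf]

/-- Translation does not preserve the fundamental domain; on the standard torus it becomes
translation by `toTorus L v`, under which Haar measure is invariant. -/
lemma LatticePeriodic.integral_translate {f : EucSpace d → ℂ} (hf : LatticePeriodic L f)
    (hc : Continuous f) (v : EucSpace d) :
    ∫ x, f (x + v) ∂latticeProb L = ∫ x, f x ∂latticeProb L := by
  have hm : Measurable fun y => periodicLift L f (y + toTorus L v) :=
    (measurable_periodicLift hc.measurable).comp (measurable_add_const _)
  rw [← hf.integral_periodicLift hc,
    ← integral_add_right_eq_self (μ := torusHaar d) _ (toTorus L v),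
    ← (measurePreserving_toTorus L).map_eq, integral_map
    (measurePreserving_toTorus L).measurable.aemeasurable
    hm.aestronglyMeasurable]
  simp only [← toTorus_add, periodicLift_toTorus hf]

lemma LatticePeriodic.fderiv {E : Type*} [NormedAddCommGroup E] [NormedSpace ℝ E]
    {f : EucSpace d → E} (hf : LatticePeriodic L f) : LatticePeriodic L (fderiv ℝ f) := by
  intro z hz x
  rw [← fderiv_comp_add_right, show (fun x => f (x + z)) = f from funext (hf z hz)]

lemma LatticePeriodic.fderiv_apply {E : Type*} [NormedAddCommGroup E] [NormedSpace ℝ E]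
    {f : EucSpace d → E} (hf : LatticePeriodic L f) (v : EucSpace d) :
    LatticePeriodic L fun x => _root_.fderiv ℝ f x v := by
  intro z hz x
  simp only [hf.fderiv z hz x]

/-- The integral of a derivative over a torus vanishes. -/
lemma LatticePeriodic.integral_fderiv {f : EucSpace d → ℂ} (hf : LatticePeriodic L f)
    (hs : ContDiff ℝ 1 f) (v : EucSpace d) : ∫ x, _root_.fderiv ℝ f x v ∂latticeProb L = 0 := by
  have hc : Continuous fun x => _root_.fderiv ℝ f x v :=
    (hs.continuous_fderiv one_ne_zero).clm_apply continuous_const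
  obtain ⟨C, hC⟩ := (hf.fderiv_apply v).exists_norm_le hc
  -- The function `t ↦ ∫ f(x + t v)` is differentiated at `t = 0` under the integral, with the
  -- constant bound `C` as dominating function. By translation invariance this function is constant,
  -- so its derivative is zero.
  have hderiv := (hasDerivAt_integral_of_dominated_loc_of_deriv_le (μ := latticeProb L)
    (F := fun (t : ℝ) x => f (x + t • v)) (F' := fun t x => _root_.fderiv ℝ f (x + t • v) v)
    (x₀ := 0) (s := univ) (bound := fun _ => C) univ_mem
    (Eventually.of_forall fun t => (hs.continuous.comp (by fun_prop)).aestronglyMeasurable)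
    (by simpa using (hf.memLp hs.continuous 1).integrable le_rfl)
    ((hc.comp (by fun_prop : Continuous fun x => x + (0 : ℝ) • v)).aestronglyMeasurable)
    (ae_of_all _ fun x t _ => hC _) (integrable_const _)
    (ae_of_all _ fun x t _ => by
      have h1 : HasDerivAt (fun t : ℝ => x + t • v) v t := by
        simpa using ((hasDerivAt_id t).smul_const v).const_add x
      exact ((hs.differentiable one_ne_zero).differentiableAt.hasFDerivAt).comp_hasDerivAt t h1)).2
  have hconst : (fun t : ℝ => ∫ x, f (x + t • v) ∂latticeProb L) =
      fun _ => ∫ x, f x ∂latticeProb L :=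
    funext fun t => hf.integral_translate hs.continuous (t • v)
  rw [hconst] at hderiv
  simpa using hderiv.unique (hasDerivAt_const _ _)

variable (L) in
/-- The element of the dual lattice with integer coordinates `n`. -/
noncomputable def dualVector (n : Fin d → ℤ) : EucSpace d →L[ℝ] ℝ :=
  LinearMap.toContinuousLinearMap (∑ i, (n i : ℝ) • L.coord i)

lemma dualVector_apply (n : Fin d → ℤ) (x : EucSpace d) :
    dualVector L n x = ∑ i, (n i : ℝ) * L.repr x i := by
  simp [dualVector]

lemma dualVector_basis (n : Fin d → ℤ) (i : Fin d) : dualVector L n (L i) = n i := by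
  simp [dualVector_apply, Finsupp.single_apply]

/-- Integrality on the lattice is what makes the characters, and the cosines used to test `λ₁`,
periodic. -/
lemma dualVector_lattice (n : Fin d → ℤ) {z : EucSpace d}
    (hz : z ∈ Submodule.span ℤ (range L)) : ∃ m : ℤ, dualVector L n z = m := by
  induction hz using Submodule.span_induction with
  | mem x hx =>
    obtain ⟨i, rfl⟩ := hx
    exact ⟨n i, dualVector_basis n i⟩
  | zero => exact ⟨0, by simp⟩
  | add x y _ _ hx hy =>
    obtain ⟨a, ha⟩ := hx
    obtain ⟨b, hb⟩ := hy
    exact ⟨a + b, by rw [map_add, ha, hb]; push_cast; rfl⟩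
  | smul k x _ hx =>
    obtain ⟨a, ha⟩ := hx
    exact ⟨k * a, by rw [map_zsmul, ha]; simp⟩

variable (L) in
/-- The character of the torus `ℝᵈ / Λ` of index `n`. -/
noncomputable def latticeChar (n : Fin d → ℤ) (x : EucSpace d) : ℂ :=
  Complex.exp (2 * Real.pi * Complex.I * dualVector L n x)

/-- In lattice coordinates the characters are the standard monomials, so the completeness of the
latter serves for every lattice. -/
lemma latticeChar_eq_mFourier (n : Fin d → ℤ) (x : EucSpace d) :
    latticeChar L n x = UnitAddTorus.mFourier n (toTorus L x) := by
  simp only [latticeChar, UnitAddTorus.mFourier, ContinuousMap.coe_mk, toTorus,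
    fourier_coe_apply, dualVector_apply]
  rw [← Complex.exp_sum]
  push_cast
  rw [Finset.mul_sum]
  congr 1
  refine Finset.sum_congr rfl fun i _ => ?_
  ring

lemma latticePeriodic_latticeChar (n : Fin d → ℤ) : LatticePeriodic L (latticeChar L n) := by
  intro z hz x
  obtain ⟨m, hm⟩ := dualVector_lattice n hz
  rw [latticeChar, latticeChar, map_add, hm]
  push_cast
  rw [mul_add, Complex.exp_add, mul_comm _ (m : ℂ), Complex.exp_int_mul_two_pi_mul_I, mul_one]

lemma contDiff_latticeChar (n : Fin d → ℤ) : ContDiff ℝ 1 (latticeChar L n) := by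
  unfold latticeChar
  have : ContDiff ℝ 1 fun x => (dualVector L n x : ℂ) :=
    Complex.ofRealCLM.contDiff.comp (dualVector L n).contDiff
  fun_prop

lemma fderiv_latticeChar_apply (n : Fin d → ℤ) (x v : EucSpace d) :
    fderiv ℝ (latticeChar L n) x v =
      2 * Real.pi * Complex.I * dualVector L n v * latticeChar L n x := by
  have h1 : HasFDerivAt (fun x => (dualVector L n x : ℂ))
      (Complex.ofRealCLM ∘L dualVector L n) x :=
    (Complex.ofRealCLM ∘L dualVector L n).hasFDerivAt
  have h2 := (h1.const_mul (2 * Real.pi * Complex.I)).cexp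
  have h3 : fderiv ℝ (latticeChar L n) x = _ := h2.fderiv
  rw [h3]
  simp [latticeChar]
  ring

variable (L) in
/-- The Fourier coefficient of index `n` of a function on the torus `ℝᵈ / Λ`. -/
noncomputable def latticeCoeff (f : EucSpace d → ℂ) (n : Fin d → ℤ) : ℂ :=
  ∫ x, latticeChar L (-n) x * f x ∂latticeProb L

/-- Parseval's identity on the torus `ℝᵈ / Λ`. -/
lemma LatticePeriodic.hasSum_sq_latticeCoeff {f : EucSpace d → ℂ} (hf : LatticePeriodic L f)
    (hc : Continuous f) :
    HasSum (fun n => ‖latticeCoeff L f n‖ ^ 2) (∫ x, ‖f x‖ ^ 2 ∂latticeProb L) := by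
  have hq := measurePreserving_toTorus L
  have hm := measurable_periodicLift (L := L) hc.measurable
  have hcomp : periodicLift L f ∘ toTorus L = f := funext (periodicLift_toTorus hf)
  have hLp : MemLp (periodicLift L f) 2 (torusHaar d) := by
    rw [← hq.map_eq, memLp_map_measure_iff hm.aestronglyMeasurable hq.measurable.aemeasurable, hcomp]
    exact hf.memLp hc 2
  have hP := UnitAddTorus.hasSum_sq_mFourierCoeff (hLp.toLp _)
  have hae := hLp.coeFn_toLp
  have hI : ∫ t, ‖hLp.toLp _ t‖ ^ 2 ∂torusHaar d = ∫ x, ‖f x‖ ^ 2 ∂latticeProb L := by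
    rw [integral_congr_ae (g := fun t => ‖periodicLift L f t‖ ^ 2) (by
      -- Parseval's identity concerns an `L²` class; its representative is replaced by the actual
      -- function before the integral is pulled back along the covering.
      filter_upwards [hae] with t ht
      rw [ht]), ← hq.map_eq, integral_map hq.measurable.aemeasurable
      (hm.norm.pow_const 2).aestronglyMeasurable]
    simp only [periodicLift_toTorus hf]
  have hC : ∀ n, ∫ t, UnitAddTorus.mFourier (-n) t • hLp.toLp _ t ∂torusHaar d =
      latticeCoeff L f n := by
    intro n
    have hn : Measurable fun t => UnitAddTorus.mFourier (-n) t * periodicLift L f t :=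
      (UnitAddTorus.mFourier (-n)).continuous.measurable.mul hm
    rw [integral_congr_ae (g := fun t => UnitAddTorus.mFourier (-n) t * periodicLift L f t) (by
      filter_upwards [hae] with t ht
      rw [ht, smul_eq_mul]), ← hq.map_eq, integral_map hq.measurable.aemeasurable
      hn.aestronglyMeasurable]
    simp only [periodicLift_toTorus hf, ← latticeChar_eq_mFourier]
    rfl
  rw [← hI]
  simp only [← hC]
  exact hP

/-- Integration by parts: the derivative of `χ_{-n} f` has integral zero, and differentiating the
character produces the factor `-2πi n*(v)`, where `n*` is the dual vector of `n`. -/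
lemma LatticePeriodic.latticeCoeff_fderiv {f : EucSpace d → ℂ} (hf : LatticePeriodic L f)
    (hs : ContDiff ℝ 1 f) (v : EucSpace d) (n : Fin d → ℤ) :
    latticeCoeff L (fun x => _root_.fderiv ℝ f x v) n =
      2 * Real.pi * Complex.I * dualVector L n v * latticeCoeff L f n := by
  have hχ := contDiff_latticeChar (L := L) (-n)
  have hper : LatticePeriodic L fun x => latticeChar L (-n) x * f x := by
    intro z hz x
    simp only [latticePeriodic_latticeChar (-n) z hz x, hf z hz x]
  have hf' : Continuous fun x => _root_.fderiv ℝ f x v :=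
    (hs.continuous_fderiv one_ne_zero).clm_apply continuous_const
  have hper' : LatticePeriodic L fun x => latticeChar L (-n) x * _root_.fderiv ℝ f x v := by
    intro z hz x
    simp only [latticePeriodic_latticeChar (-n) z hz x, hf.fderiv_apply v z hz x]
  have h0 := hper.integral_fderiv (hχ.mul hs) v
  have hneg : dualVector L (-n) v = -dualVector L n v := by
    simp [dualVector_apply]
  have hd : ∀ x, _root_.fderiv ℝ (fun x => latticeChar L (-n) x * f x) x v =
      latticeChar L (-n) x * _root_.fderiv ℝ f x v -
        2 * Real.pi * Complex.I * dualVector L n v * (latticeChar L (-n) x * f x) := by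
    intro x
    rw [fderiv_fun_mul (hχ.differentiable one_ne_zero).differentiableAt
      (hs.differentiable one_ne_zero).differentiableAt, add_apply, smul_apply, smul_apply,
      fderiv_latticeChar_apply, hneg, smul_eq_mul, smul_eq_mul]
    push_cast
    ring
  simp only [hd] at h0
  rw [integral_sub ((hper'.memLp (hχ.continuous.mul hf') 1).integrable le_rfl)
    (((hper.memLp (hχ.continuous.mul hs.continuous) 1).integrable le_rfl).const_mul _),
    integral_const_mul, sub_eq_zero] at h0
  exact h0

end FlatTorus

/-! ### The Poincaré inequality with constant `1/λ₁` on a flat 2-torus. -/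

section Poincare

variable (L : Module.Basis (Fin 2) ℝ (EucSpace 2))

open InnerProductSpace Laplacian

lemma laplacian_cos_linear (ℓ : EucSpace 2 →L[ℝ] ℝ) (x : EucSpace 2) :
    (Δ fun y => Real.cos (ℓ y)) x =
      -(∑ j, ℓ (EuclideanSpace.single j 1) ^ 2) * Real.cos (ℓ x) := by
  have h1 : fderiv ℝ (fun y => Real.cos (ℓ y)) = fun y => -Real.sin (ℓ y) • ℓ := by
    ext1 y
    exact ℓ.hasFDerivAt.cos.fderiv
  have h2 : fderiv ℝ (fun y => -Real.sin (ℓ y) • ℓ) x = (-(Real.cos (ℓ x) • ℓ)).smulRight ℓ :=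
    (ℓ.hasFDerivAt.sin.neg.smul_const ℓ).fderiv
  rw [laplacian_eq_iteratedFDeriv_orthonormalBasis _ (EuclideanSpace.basisFun (Fin 2) ℝ)]
  simp only [iteratedFDeriv_two_apply, h1, h2]
  rw [← Finset.sum_neg_distrib, Finset.sum_mul]
  refine Finset.sum_congr rfl fun j _ => ?_
  simp
  ring

/-- The real part `cos(2π n*(x))` of the character is a smooth periodic eigenfunction, so its
eigenvalue competes in the infimum that defines `λ₁`. The condition `n ≠ 0` makes this eigenvalue
positive, since `n* = 0` would force `n i = n*(L i) = 0`. -/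
lemma torusLambdaOne_le {n : Fin 2 → ℤ} (hn : n ≠ 0) :
    torusLambdaOne L ≤ (2 * Real.pi) ^ 2 * ∑ j, dualVector L n (EuclideanSpace.single j 1) ^ 2 := by
  refine csInf_le ⟨0, fun l hl => hl.1.le⟩ ⟨?_, ?_⟩
  · refine mul_pos (by positivity) ?_
    refine (Finset.sum_nonneg fun j _ => sq_nonneg _).lt_of_ne' fun h0 => hn ?_
    have hz : ∀ j, dualVector L n (EuclideanSpace.single j 1) = 0 := fun j =>
      pow_eq_zero_iff two_ne_zero |>.1
        ((Finset.sum_eq_zero_iff_of_nonneg fun j _ => sq_nonneg _).1 h0 j (Finset.mem_univ j))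
    have hℓ : dualVector L n = 0 := by
      ext x
      have hx : x = ∑ j, x j • (EuclideanSpace.single j (1 : ℝ) : EucSpace 2) := by
        ext m
        fin_cases m <;> simp
      rw [hx, map_sum]
      simp [hz]
    ext i
    have := dualVector_basis (L := L) n i
    rw [hℓ] at this
    simpa using this.symm
  · refine ⟨fun x => Real.cos (((2 * Real.pi) • dualVector L n) x), ?_, ?_, ?_, fun x => ?_⟩
    · exact Real.contDiff_cos.comp (ContinuousLinearMap.contDiff _)
    · intro h
      simpa using congrFun h 0
    · intro z hz x
      obtain ⟨m, hm⟩ := dualVector_lattice n hz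
      have : ((2 * Real.pi) • dualVector L n) (x + z) =
          ((2 * Real.pi) • dualVector L n) x + m * (2 * Real.pi) := by
        rw [map_add]
        congr 1
        rw [smul_apply, hm, smul_eq_mul, mul_comm]
      simp only [this, Real.cos_add_int_mul_two_pi]
    · rw [laplacian_cos_linear]
      simp only [smul_apply, smul_eq_mul, mul_pow, ← Finset.mul_sum]
      ring

variable {L}

/-- The Poincaré inequality on the flat torus `ℝ² / Λ`. -/
theorem torusLambdaOne_mul_integral_le {f : EucSpace 2 → ℂ} (hf : LatticePeriodic L f)
    (hs : ContDiff ℝ 1 f) (h0 : ∫ x, f x ∂latticeProb L = 0) :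
    torusLambdaOne L * ∫ x, ‖f x‖ ^ 2 ∂latticeProb L ≤
      ∫ x, ∑ j, ‖fderiv ℝ f x (EuclideanSpace.single j 1)‖ ^ 2 ∂latticeProb L := by
  have hf' : ∀ v, Continuous fun x => fderiv ℝ f x v := fun v =>
    (hs.continuous_fderiv one_ne_zero).clm_apply continuous_const
  have hP := (hf.hasSum_sq_latticeCoeff hs.continuous).mul_left (torusLambdaOne L)
  have hQ := hasSum_sum (s := Finset.univ) fun (j : Fin 2) _ =>
    (hf.fderiv_apply (EuclideanSpace.single j 1)).hasSum_sq_latticeCoeff (hf' _)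
  rw [← integral_finsetSum _ fun j _ =>
    ((hf.fderiv_apply _).memLp (hf' (EuclideanSpace.single j 1)) 2).integrable_norm_pow two_ne_zero] at hQ
  -- Parseval's identity on both sides reduces the claim to `λ₁ |c_n|² ≤ ∑_j |2π n*(e_j)|² |c_n|²`
  -- for each frequency `n`.
  refine hasSum_le (fun n => ?_) hP hQ
  simp only [hf.latticeCoeff_fderiv hs, norm_mul, mul_pow]
  rcases eq_or_ne n 0 with rfl | hn
  -- The zero frequency, which has no gradient, is excluded by the vanishing mean.
  · have : latticeCoeff L f 0 = 0 := by
      simpa [latticeCoeff, latticeChar, dualVector] using h0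
    simp [this]
  · rw [← Finset.sum_mul]
    refine mul_le_mul_of_nonneg_right ((torusLambdaOne_le L hn).trans_eq ?_) (sq_nonneg _)
    rw [Finset.mul_sum]
    refine Finset.sum_congr rfl fun j _ => ?_
    simp [abs_of_pos Real.pi_pos, mul_pow]

end Poincare

/-! ### Mean square deviation on a probability space. -/

section MeasurePreliminaries

variable {α : Type*} [MeasurableSpace α] {μ : Measure α}

lemma lintegral_enorm_sq_eq_ofReal_integral {f : α → ℂ} (hf : MemLp f 2 μ) :
    ∫⁻ x, ‖f x‖ₑ ^ 2 ∂μ = ENNReal.ofReal (∫ x, ‖f x‖ ^ 2 ∂μ) := by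
  rw [ofReal_integral_eq_lintegral_ofReal (hf.integrable_norm_pow two_ne_zero)
    (ae_of_all _ fun x => by positivity)]
  refine lintegral_congr fun x => ?_
  rw [ENNReal.ofReal_pow (norm_nonneg _), ofReal_norm]

/-- The mean minimizes the mean square deviation. -/
lemma lintegral_enorm_sub_integral_sq_le [IsProbabilityMeasure μ] {f : α → ℂ} (hf : MemLp f 2 μ)
    (k : ℂ) : ∫⁻ x, ‖f x - ∫ y, f y ∂μ‖ₑ ^ 2 ∂μ ≤ ∫⁻ x, ‖f x - k‖ₑ ^ 2 ∂μ := by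
  set m := ∫ y, f y ∂μ with hm
  have hfi : Integrable f μ := hf.integrable (by norm_num)
  have h1 : MemLp (fun x => f x - m) 2 μ := hf.sub (memLp_const m)
  have h2 : MemLp (fun x => f x - k) 2 μ := hf.sub (memLp_const k)
  rw [lintegral_enorm_sq_eq_ofReal_integral h1, lintegral_enorm_sq_eq_ofReal_integral h2]
  refine ENNReal.ofReal_le_ofReal ?_
  have hsub : Integrable (fun x => f x - m) μ := hfi.sub (integrable_const m)
  have hcross : Integrable (fun x => inner ℂ (m - k) (f x - m)) μ :=
    hsub.const_inner (m - k)
  -- Since `f - m` has mean zero, the cross term drops out of the expansion around `m`, leaving the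
  -- excess `‖m - k‖²`.
  have hz : ∫ x, RCLike.re (inner ℂ (m - k) (f x - m)) ∂μ = 0 := by
    rw [integral_re hcross, integral_inner hsub,
      integral_sub hfi (integrable_const m)]
    simp [hm]
  have hexp : ∀ x, ‖f x - k‖ ^ 2 = ‖m - k‖ ^ 2 +
      2 * RCLike.re (inner ℂ (m - k) (f x - m)) + ‖f x - m‖ ^ 2 := by
    intro x
    rw [← norm_add_sq (𝕜 := ℂ)]
    congr 2
    ring
  have hcross2 : Integrable (fun x => 2 * RCLike.re (inner ℂ (m - k) (f x - m))) μ :=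
    hcross.re.const_mul 2
  have hadd : Integrable (fun x => ‖m - k‖ ^ 2 + 2 * RCLike.re (inner ℂ (m - k) (f x - m))) μ :=
    (integrable_const _).add hcross2
  simp only [hexp]
  rw [integral_add hadd
    (h1.integrable_norm_pow two_ne_zero), integral_add (integrable_const _) hcross2,
    integral_const_mul, hz]
  simp only [integral_const, probReal_univ, one_smul, mul_zero, add_zero]
  exact le_add_of_nonneg_left (sq_nonneg _)

end MeasurePreliminaries

/-! ### Derivatives along a fiber against the full gradient. -/

section GradientComparison

/-- If `Qᵀ S Q ≤ κ` then `Q Qᵀ ≤ κ S⁻¹`. -/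
lemma sq_vecMul_le_of_quadratic_le {m k : ℕ} {S : Matrix (Fin m) (Fin m) ℝ} (hS : S.PosDef)
    {Q : Matrix (Fin m) (Fin k) ℝ} {κ : ℝ} (hκ : 0 < κ)
    (h : ∀ z, Q.mulVec z ⬝ᵥ S.mulVec (Q.mulVec z) ≤ κ * (z ⬝ᵥ z)) (w : Fin m → ℝ) :
    Matrix.vecMul w Q ⬝ᵥ Matrix.vecMul w Q ≤ κ * (w ⬝ᵥ S⁻¹.mulVec w) := by
  set z := Matrix.vecMul w Q with hz
  have hunit : IsUnit S.det := isUnit_iff_ne_zero.2 hS.det_pos.ne'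
  -- Positivity of `S` is tested on `S⁻¹ w - κ⁻¹ Q z` with `z = Qᵀ w`. The result is `w·S⁻¹w -
  -- 2κ⁻¹|z|² + κ⁻² Qz·SQz ≥ 0`, and the hypothesis bounds the last term by `κ⁻¹|z|²`.
  have hpos := hS.posSemidef.dotProduct_mulVec_nonneg (S⁻¹.mulVec w - κ⁻¹ • Q.mulVec z)
  have hSS : S.mulVec (S⁻¹.mulVec w) = w := by
    rw [Matrix.mulVec_mulVec, Matrix.mul_nonsing_inv _ hunit, Matrix.one_mulVec]
  have hwQ : Q.mulVec z ⬝ᵥ w = z ⬝ᵥ z := by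
    rw [dotProduct_comm, Matrix.dotProduct_mulVec]
  have hsymm : ∀ a b : Fin m → ℝ, a ⬝ᵥ S.mulVec b = b ⬝ᵥ S.mulVec a := by
    intro a b
    have hT : S.transpose = S := by simpa using hS.isHermitian.eq
    rw [Matrix.dotProduct_mulVec, ← Matrix.mulVec_transpose, hT, dotProduct_comm]
  rw [star_trivial, Matrix.mulVec_sub, Matrix.mulVec_smul, hSS, sub_dotProduct, dotProduct_sub,
    dotProduct_sub, smul_dotProduct, smul_dotProduct, dotProduct_smul, dotProduct_smul,
    hsymm (S⁻¹.mulVec w), hSS, hwQ, dotProduct_comm (S⁻¹.mulVec w) w] at hpos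
  simp only [smul_eq_mul] at hpos
  have h1 := h z
  have h2 : κ⁻¹ * (κ⁻¹ * (Q.mulVec z ⬝ᵥ S.mulVec (Q.mulVec z))) ≤ κ⁻¹ * (z ⬝ᵥ z) := by
    refine mul_le_mul_of_nonneg_left ?_ (by positivity)
    rw [inv_mul_le_iff₀ hκ]
    exact h1
  have h3 : κ⁻¹ * (z ⬝ᵥ z) ≤ w ⬝ᵥ S⁻¹.mulVec w := by linarith
  rwa [inv_mul_le_iff₀ hκ] at h3

/-- The matrices are real, so the real and imaginary parts of `w` decouple. This dualizes a bound on
tangent vectors, for the metric, into one on differentials, for the inverse metric. -/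
lemma sum_norm_sq_le_hermForm {m k : ℕ} {S : Matrix (Fin m) (Fin m) ℝ} (hS : S.PosDef)
    {Q : Matrix (Fin m) (Fin k) ℝ} {κ : ℝ} (hκ : 0 < κ)
    (h : ∀ z, Q.mulVec z ⬝ᵥ S.mulVec (Q.mulVec z) ≤ κ * (z ⬝ᵥ z)) (w : Fin m → ℂ) :
    ∑ j, ‖∑ i, (Q i j : ℂ) * w i‖ ^ 2 ≤
      κ * (star w ⬝ᵥ (S⁻¹.map (algebraMap ℝ ℂ)).mulVec w).re := by
  have h1 := sq_vecMul_le_of_quadratic_le hS hκ h fun i => (w i).re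
  have h2 := sq_vecMul_le_of_quadratic_le hS hκ h fun i => (w i).im
  refine (Eq.trans_le ?_ (add_le_add h1 h2)).trans_eq ?_
  · simp only [dotProduct, Matrix.vecMul, ← Finset.sum_add_distrib]
    refine Finset.sum_congr rfl fun j _ => ?_
    rw [← Complex.normSq_eq_norm_sq, Complex.normSq_apply]
    simp [Complex.re_sum, Complex.im_sum, mul_comm]
  · rw [← mul_add]
    congr 1
    simp only [dotProduct, Matrix.mulVec, Complex.re_sum, Pi.star_apply,
      Matrix.map_apply, Complex.mul_re, Complex.im_sum, Complex.mul_im, Complex.star_def,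
      Complex.conj_re, Complex.conj_im, Complex.coe_algebraMap, Complex.ofReal_re,
      Complex.ofReal_im, zero_mul, sub_zero, add_zero, neg_mul, sub_neg_eq_add,
      Finset.sum_add_distrib]

namespace FlatTorusFibration

variable {B : Type*} [TopologicalSpace B] [ChartedSpace (EucSpace 2) B] [IsManifold (𝓡 2) ∞ B]
  {B₀ : TopologicalSpace.Opens B}
  {X : Type*} [TopologicalSpace X] [ChartedSpace (EucSpace 4) X] [IsManifold (𝓡 4) ∞ X]

lemma proj_param (F : FlatTorusFibration B₀ X) {b : B} (hb : b ∈ B₀) (a : EucSpace 2) :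
    F.proj (F.param b a) = b := by
  have : F.param b a ∈ F.proj ⁻¹' {b} := by
    rw [← F.range_param b hb]; exact mem_range_self a
  exact this

/-- The composite of the projection with the parametrization of one fiber is constant, so the
parametrization has vertical derivative. -/
lemma mfderiv_proj_mfderiv_param (F : FlatTorusFibration B₀ X) {b : B} (hb : b ∈ B₀)
    (a v : EucSpace 2) :
    mfderiv (𝓡 4) (𝓡 2) F.proj (F.param b a) (mfderiv (𝓡 2) (𝓡 4) (F.param b) a v) = 0 := by
  have h1 := mfderiv_comp (I := 𝓡 2) (I' := 𝓡 4) (I'' := 𝓡 2) a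
    (F.contMDiff_proj.mdifferentiableAt (by simp))
    ((F.contMDiff_param b hb).mdifferentiableAt (x := a) (by simp))
  have h2 : F.proj ∘ F.param b = fun _ => b := funext (F.proj_param hb)
  have h3 : mfderiv (𝓡 2) (𝓡 2) (F.proj ∘ F.param b) a = 0 := by
    rw [h2]; exact mfderiv_const
  exact (DFunLike.congr_fun h1 v).symm.trans (DFunLike.congr_fun h3 v)

/-- Semi-flat control on vertical vectors. -/
lemma SemiFlatControl.inner_param_le {F : FlatTorusFibration B₀ X} {gB : SmoothMetric 2 B}
    {g : SmoothMetric 4 X} {ε : ℝ} (h : F.SemiFlatControl gB g ε) {b : B} (hb : b ∈ B₀)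
    (a v : EucSpace 2) :
    g.inner (F.param b a) (mfderiv (𝓡 2) (𝓡 4) (F.param b) a v)
      (mfderiv (𝓡 2) (𝓡 4) (F.param b) a v) ≤ (1 + ε) * ‖v‖ ^ 2 := by
  have hpb : F.proj (F.param b a) ∈ B₀ := by rw [F.proj_param hb]; exact hb
  have hvert := F.mfderiv_proj_mfderiv_param hb a v
  -- On a vertical vector the base term vanishes and the splitting acts as the identity, so only the
  -- flat fiber metric remains, and the parametrization is isometric for it.
  have href : F.refMetric gB (F.param b a) (mfderiv (𝓡 2) (𝓡 4) (F.param b) a v)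
      (mfderiv (𝓡 2) (𝓡 4) (F.param b) a v) = ‖v‖ ^ 2 := by
    rw [refMetric, hvert, F.vert_eq_self _ hpb _ hvert, F.param_isometry b hb,
      real_inner_self_eq_norm_sq, map_zero, zero_add]
  have h1 := h (F.param b a) hpb (mfderiv (𝓡 2) (𝓡 4) (F.param b) a v)
  rw [href] at h1
  linarith [(abs_le.1 h1).2]

/-- The squared gradient along the fiber is controlled by the full gradient. -/
lemma SemiFlatControl.sum_norm_fderiv_sq_le {F : FlatTorusFibration B₀ X} {gB : SmoothMetric 2 B}
    {g : SmoothMetric 4 X} {ε : ℝ} (h : F.SemiFlatControl gB g ε) (hε : 0 < 1 + ε) {u : X → ℂ}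
    (hu : ContMDiff (𝓡 4) 𝓘(ℝ, ℂ) ∞ u) {b : B} (hb : b ∈ B₀) (a : EucSpace 2) :
    ∑ j, ‖fderiv ℝ (u ∘ F.param b) a (EuclideanSpace.single j 1)‖ ^ 2 ≤
      (1 + ε) * (gradInner g u u (F.param b a)).re := by
  set p := F.param b a with hp
  let T : EucSpace 2 →L[ℝ] EucSpace 4 := mfderiv (𝓡 2) (𝓡 4) (F.param b) a
  let du : EucSpace 4 →L[ℝ] ℂ := mfderiv (𝓡 4) 𝓘(ℝ, ℂ) u p
  -- `Q` is the matrix of the derivative of the parametrization; with `S` the matrix of `g`, the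
  -- control on vertical vectors reads `Qᵀ S Q ≤ 1 + ε`.
  let Q : Matrix (Fin 4) (Fin 2) ℝ := Matrix.of fun i j => T (EuclideanSpace.single j 1) i
  have hT : ∀ v : EucSpace 2, T v = ∑ i, (Q.mulVec fun j => v j) i •
      (EuclideanSpace.single i (1 : ℝ) : EucSpace 4) := by
    intro v
    have hv : v = ∑ j, v j • (EuclideanSpace.single j (1 : ℝ) : EucSpace 2) := by
      ext m
      fin_cases m <;> simp
    conv_lhs => rw [hv]
    ext m
    simp [Q, Matrix.mulVec, dotProduct, Pi.single_apply, mul_comm]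
  have hquad : ∀ z, Q.mulVec z ⬝ᵥ (metricMatrix g p).mulVec (Q.mulVec z) ≤ (1 + ε) * (z ⬝ᵥ z) := by
    intro z
    have h1 := h.inner_param_le hb a (WithLp.toLp 2 z)
    have h2 : (‖(WithLp.toLp 2 z : EucSpace 2)‖ ^ 2 : ℝ) = z ⬝ᵥ z := by
      rw [EuclideanSpace.norm_sq_eq]
      simp [dotProduct, pow_two]
    rw [h2] at h1
    refine Eq.trans_le ?_ h1
    have h3 : g.inner p (T (WithLp.toLp 2 z)) (T (WithLp.toLp 2 z)) = _ :=
      congrArg₂ (fun x y => g.inner p x y) (hT (WithLp.toLp 2 z)) (hT (WithLp.toLp 2 z))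
    refine Eq.trans ?_ h3.symm
    exact ((bilin_sum_sum (g.inner p) _ _ _).trans
      (by simp only [dotProduct, Matrix.mulVec]; rfl)).symm
  have hfd : ∀ j, fderiv ℝ (u ∘ F.param b) a (EuclideanSpace.single j 1) =
      ∑ i, (Q i j : ℂ) * diffComponents 4 u p i := by
    intro j
    have h6 := mfderiv_comp (I := 𝓡 2) (I' := 𝓡 4) (I'' := 𝓘(ℝ, ℂ)) a
      (hu.mdifferentiableAt (by simp)) ((F.contMDiff_param b hb).mdifferentiableAt (x := a) (by simp))
    rw [← mfderiv_eq_fderiv]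
    refine (DFunLike.congr_fun h6 (EuclideanSpace.single j 1)).trans ?_
    change du (T (EuclideanSpace.single j 1)) = _
    rw [hT, map_sum]
    refine Finset.sum_congr rfl fun i _ => ?_
    rw [map_smul, Complex.real_smul]
    congr 2
    simp [Matrix.mulVec, dotProduct]
  simp only [hfd]
  exact sum_norm_sq_le_hermForm (metricMatrix_posDef g p) hε hquad _

variable [MeasurableSpace X] [BorelSpace X]

lemma latticePeriodic_comp_param (F : FlatTorusFibration B₀ X) {b : B} (hb : b ∈ B₀)
    {α : Type*} (u : X → α) : LatticePeriodic (F.lattice b) (u ∘ F.param b) := by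
  intro z hz x
  have : F.param b (x + z) = F.param b x := by
    rw [F.param_eq_iff b hb]
    simpa using hz
  simp only [Function.comp, this]

lemma lintegral_fiberHaar (F : FlatTorusFibration B₀ X) {b : B} (hb : b ∈ B₀) {f : X → ℝ≥0∞}
    (hf : Measurable f) :
    ∫⁻ x, f x ∂F.fiberHaar b = ∫⁻ a, f (F.param b a) ∂latticeProb (F.lattice b) :=
  lintegral_map hf (F.contMDiff_param b hb).continuous.measurable

/-- The Poincaré inequality on a fiber, with the full gradient of the total space. -/
lemma SemiFlatControl.exists_lintegral_fiberHaar_le {F : FlatTorusFibration B₀ X}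
    {gB : SmoothMetric 2 B} {g : SmoothMetric 4 X} {ε : ℝ} (h : F.SemiFlatControl gB g ε)
    (hε : 0 < 1 + ε) {u : X → ℂ} (hu : ContMDiff (𝓡 4) 𝓘(ℝ, ℂ) ∞ u) {b : B} (hb : b ∈ B₀)
    {l : ℝ} (hl : 0 < l) (hlb : l ≤ F.fiberLambdaOne b) :
    ∃ k : ℂ, ∫⁻ x, ‖u x - k‖ₑ ^ 2 ∂F.fiberHaar b ≤
      ENNReal.ofReal (l⁻¹ * (1 + ε)) * ∫⁻ x, ENNReal.ofReal (gradInner g u u x).re ∂F.fiberHaar b := by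
  set L := F.lattice b
  set f := u ∘ F.param b with hf
  have hfper : LatticePeriodic L f := F.latticePeriodic_comp_param hb u
  have hfs : ContDiff ℝ 1 f :=
    (contMDiff_iff_contDiff.1 (hu.comp (F.contMDiff_param b hb))).of_le (by simp)
  -- The constant is the Haar mean on the fiber. Its value may be forgotten, since the mean for `ρ
  -- ϑ_b` will do at least as well for `ρ ϑ_b`.
  set k := ∫ a, f a ∂latticeProb L with hk
  have hsper : LatticePeriodic L fun a => f a - k := fun z hz x => by simp only [hfper z hz x]
  have hss : ContDiff ℝ 1 fun a => f a - k := hfs.sub contDiff_const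
  have hmean : ∫ a, f a - k ∂latticeProb L = 0 := by
    rw [integral_sub ((hfper.memLp hfs.continuous 1).integrable le_rfl) (integrable_const k)]
    simp [hk]
  have hP := torusLambdaOne_mul_integral_le hsper hss hmean
  simp only [fderiv_sub_const] at hP
  have hgc : Continuous (gradInner g u u) := continuous_gradInner g hu hu
  have hpc := (F.contMDiff_param b hb).continuous
  have hgi : Integrable (fun a => (gradInner g u u (F.param b a)).re) (latticeProb L) :=
    ((F.latticePeriodic_comp_param hb fun x => (gradInner g u u x).re).memLp
      ((Complex.continuous_re.comp hgc).comp hpc) 1).integrable le_rfl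
  have hle : ∫ a, ‖f a - k‖ ^ 2 ∂latticeProb L ≤
      l⁻¹ * (1 + ε) * ∫ a, (gradInner g u u (F.param b a)).re ∂latticeProb L := by
    rw [mul_assoc, ← div_eq_inv_mul, le_div_iff₀ hl, mul_comm _ l]
    refine (mul_le_mul_of_nonneg_right hlb (integral_nonneg fun a => sq_nonneg _)).trans
      (hP.trans ?_)
    rw [← integral_const_mul]
    refine integral_mono_of_nonneg (ae_of_all _ fun a => Finset.sum_nonneg fun j _ => sq_nonneg _)
      (hgi.const_mul _) (ae_of_all _ fun a => ?_)
    exact h.sum_norm_fderiv_sq_le hε hu hb a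
  have hgm : Measurable fun x => ENNReal.ofReal (gradInner g u u x).re :=
    (Complex.measurable_re.comp hgc.measurable).ennreal_ofReal
  refine ⟨k, ?_⟩
  rw [F.lintegral_fiberHaar hb ((hu.continuous.measurable.sub_const k).enorm.pow_const 2),
    F.lintegral_fiberHaar hb hgm,
    ← ofReal_integral_eq_lintegral_ofReal hgi (ae_of_all _ fun a => gradInner_self_nonneg g u _),
    ← ENNReal.ofReal_mul (by positivity)]
  refine Eq.trans_le (lintegral_enorm_sq_eq_ofReal_integral (hsper.memLp hss.continuous 2)) ?_
  exact ENNReal.ofReal_le_ofReal hle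

end FlatTorusFibration

end GradientComparison

/-! ### The Dirichlet energy as the excess of the form norm over the `L²` norm. -/

section FormEnergy

variable {n : ℕ} {M : Type*} [TopologicalSpace M] [ChartedSpace (EucSpace n) M]
  [IsManifold (𝓡 n) ∞ M] [MeasurableSpace M] [BorelSpace M]

lemma norm_testInclusion_le (g : SmoothMetric n M) (Ω : Set M) (u : TestSpace g Ω) :
    ‖testInclusion g Ω u‖ ≤ ‖u‖ := by
  exact (norm_testToLp_le g Ω u).trans_eq (one_mul _)

/-- The form norm exceeds the `L²` norm by the Dirichlet energy. -/
lemma norm_sq_sub_norm_testInclusion_sq (g : SmoothMetric n M) (Ω : Set M) (u : TestSpace g Ω) :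
    ‖u‖ ^ 2 - ‖testInclusion g Ω u‖ ^ 2 =
      ∫ x in Ω, (gradInner g u.1 u.1 x).re ∂riemannianMeasure g := by
  have h := integral_re (testFunctions_integrable_gradInner g u.2 u.2)
  rw [← inner_self_eq_norm_sq (𝕜 := ℂ) u, testSpace_inner_def, map_add, inner_self_eq_norm_sq]
  exact (add_sub_cancel_left _ _).trans h.symm

lemma enorm_sq_eq_lintegral {α : Type*} [MeasurableSpace α] {μ : Measure α} (f : Lp ℂ 2 μ) :
    ‖f‖ₑ ^ 2 = ∫⁻ x, ‖f x‖ₑ ^ 2 ∂μ := by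
  rw [Lp.enorm_def, NormalizedDisintegration.eLpNorm_two_eq, ← ENNReal.rpow_natCast,
    ← ENNReal.rpow_mul]
  norm_num

end FormEnergy

/-! ### From the fibers to the total space, and the semigroup defect. -/

namespace NormalizedDisintegration

variable {B : Type*} [TopologicalSpace B] [ChartedSpace (EucSpace 2) B] [IsManifold (𝓡 2) ∞ B]
  [MeasurableSpace B] [BorelSpace B] {B₀ : TopologicalSpace.Opens B}
  {X : Type*} [TopologicalSpace X] [ChartedSpace (EucSpace 4) X] [IsManifold (𝓡 4) ∞ X]
  [MeasurableSpace X] [BorelSpace X]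
  {F : FlatTorusFibration B₀ X} {gB : SmoothMetric 2 B} {g : SmoothMetric 4 X}

lemma norm_lift_le [T1Space B] (N : NormalizedDisintegration F gB g) : ‖N.lift‖ ≤ 1 :=
  LinearMap.mkContinuous_norm_le _ zero_le_one _

lemma norm_average_le [T1Space B] (N : NormalizedDisintegration F gB g) : ‖N.average‖ ≤ 1 :=
  LinearMap.mkContinuous_norm_le _ zero_le_one _

/-- A bound on the density holds almost everywhere on almost every fiber. -/
lemma DensityControl.ae_fiberHaar [T1Space B] {N : NormalizedDisintegration F gB g} {δ : ℝ}
    (h : N.DensityControl δ) :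
    ∀ᵐ b ∂(riemannianMeasure gB).restrict B₀, ∀ᵐ x ∂F.fiberHaar b, |N.dens x - 1| ≤ δ := by
  filter_upwards [N.ae_fiberProb h, ae_restrict_mem B₀.isOpen.measurableSet] with b hb hbB
  -- The disintegration only sees null sets of `ρ ϑ_b`; positivity of `ρ` on the fiber turns them
  -- into null sets of `ϑ_b`.
  rw [fiberProb, ae_withDensity_iff N.measurable_dens.ennreal_ofReal] at hb
  filter_upwards [hb, ae_fiberHaar_proj_eq F hbB] with x hx hxb
  have hx0 : x ∈ F.totalSpace := by
    change F.proj x ∈ B₀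
    rw [hxb]; exact hbB
  exact hx (by simpa using N.dens_pos x hx0)

lemma lintegral_fiberProb_le (N : NormalizedDisintegration F gB g) {δ : ℝ} {b : B}
    (h : ∀ᵐ x ∂F.fiberHaar b, |N.dens x - 1| ≤ δ) {f : X → ℝ≥0∞} (hf : Measurable f) :
    ∫⁻ x, f x ∂N.fiberProb b ≤ ENNReal.ofReal (1 + δ) * ∫⁻ x, f x ∂F.fiberHaar b := by
  rw [N.lintegral_fiberProb b hf, ← lintegral_const_mul _ hf]
  refine lintegral_mono_ae ?_
  filter_upwards [h] with x hx
  rw [mul_comm]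
  gcongr
  linarith [(abs_le.1 hx).2]

lemma le_lintegral_fiberProb (N : NormalizedDisintegration F gB g) {δ : ℝ} {b : B}
    (h : ∀ᵐ x ∂F.fiberHaar b, |N.dens x - 1| ≤ δ) {f : X → ℝ≥0∞} (hf : Measurable f) :
    ENNReal.ofReal (1 - δ) * ∫⁻ x, f x ∂F.fiberHaar b ≤ ∫⁻ x, f x ∂N.fiberProb b := by
  rw [N.lintegral_fiberProb b hf, ← lintegral_const_mul _ hf]
  refine lintegral_mono_ae ?_
  filter_upwards [h] with x hx
  rw [mul_comm]
  gcongr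
  linarith [(abs_le.1 hx).1]

/-- The Poincaré inequality for the probability measure `ρ ϑ_b` of a fiber. -/
lemma lintegral_fiberProb_sub_mean_le (N : NormalizedDisintegration F gB g)
    {ε δ l : ℝ} (hsf : F.SemiFlatControl gB g ε) (hε : 0 < 1 + ε) (hδ0 : 0 < 1 + δ) (hδ1 : δ < 1)
    {u : X → ℂ} (hu : ContMDiff (𝓡 4) 𝓘(ℝ, ℂ) ∞ u) {b : B} (hb : b ∈ B₀)
    (hδ : ∀ᵐ x ∂F.fiberHaar b, |N.dens x - 1| ≤ δ) (hl : 0 < l) (hlb : l ≤ F.fiberLambdaOne b)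
    (hu2 : MemLp u 2 (N.fiberProb b)) :
    ∫⁻ x, ‖u x - ∫ y, u y ∂N.fiberProb b‖ₑ ^ 2 ∂N.fiberProb b ≤
      ENNReal.ofReal ((1 + δ) * (l⁻¹ * (1 + ε)) * (1 - δ)⁻¹) *
        ∫⁻ x, ENNReal.ofReal (gradInner g u u x).re ∂N.fiberProb b := by
  have := N.isProbabilityMeasure_fiberProb hb
  have hδ1' : 0 < 1 - δ := sub_pos.2 hδ1
  obtain ⟨k, hk⟩ := hsf.exists_lintegral_fiberHaar_le hε hu hb hl hlb
  have hgm : Measurable fun x => ENNReal.ofReal (gradInner g u u x).re :=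
    (Complex.measurable_re.comp (continuous_gradInner g hu hu).measurable).ennreal_ofReal
  have hum : Measurable fun x => ‖u x - k‖ₑ ^ 2 :=
    (hu.continuous.measurable.sub_const k).enorm.pow_const 2
  -- The mean for `ρ ϑ_b` is first exchanged for the constant `k`. The deviation then passes to Haar
  -- measure at the cost `1 + δ`, and the energy returns from it at the cost `(1 - δ)⁻¹`.
  calc _ ≤ ∫⁻ x, ‖u x - k‖ₑ ^ 2 ∂N.fiberProb b := lintegral_enorm_sub_integral_sq_le hu2 k
    _ ≤ ENNReal.ofReal (1 + δ) * ∫⁻ x, ‖u x - k‖ₑ ^ 2 ∂F.fiberHaar b :=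
      N.lintegral_fiberProb_le hδ hum
    _ ≤ ENNReal.ofReal (1 + δ) * (ENNReal.ofReal (l⁻¹ * (1 + ε)) *
        ∫⁻ x, ENNReal.ofReal (gradInner g u u x).re ∂F.fiberHaar b) := by gcongr
    _ = ENNReal.ofReal ((1 + δ) * (l⁻¹ * (1 + ε)) * (1 - δ)⁻¹) * (ENNReal.ofReal (1 - δ) *
        ∫⁻ x, ENNReal.ofReal (gradInner g u u x).re ∂F.fiberHaar b) := by
      rw [← mul_assoc, ← mul_assoc, ← ENNReal.ofReal_mul hδ0.le, ← ENNReal.ofReal_mul (by positivity),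
        mul_assoc _ (1 - δ)⁻¹, inv_mul_cancel₀ hδ1'.ne', mul_one]
    _ ≤ _ := by
      gcongr
      exact N.le_lintegral_fiberProb hδ hgm

/-- The operator `1 - I P` of the deviation from the fiber average. -/
noncomputable def fluctuation [T1Space B] (N : NormalizedDisintegration F gB g) :
    Lp ℂ 2 ((riemannianMeasure g).restrict F.totalSpace) →L[ℂ]
      Lp ℂ 2 ((riemannianMeasure g).restrict F.totalSpace) :=
  ContinuousLinearMap.id ℂ _ - N.lift ∘L N.average

/-- The deviation of a test function from its fiber average is bounded by its Dirichlet energy. -/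
lemma norm_fluctuation_sq_le [T1Space B] (N : NormalizedDisintegration F gB g)
    {ε δ l : ℝ} (hsf : F.SemiFlatControl gB g ε) (hε : 0 < 1 + ε) (hδ0 : 0 < 1 + δ) (hδ1 : δ < 1)
    (hδ : N.DensityControl δ) (hl : 0 < l) (hlb : ∀ b ∈ B₀, l ≤ F.fiberLambdaOne b)
    (u : TestSpace g F.totalSpace) :
    ‖N.fluctuation (testInclusion g F.totalSpace u)‖ ^ 2 ≤
      (1 + δ) * (l⁻¹ * (1 + ε)) * (1 - δ)⁻¹ *
        (‖u‖ ^ 2 - ‖testInclusion g F.totalSpace u‖ ^ 2) := by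
  set κ := (1 + δ) * (l⁻¹ * (1 + ε)) * (1 - δ)⁻¹ with hκ
  have hκ0 : 0 ≤ κ := by
    have : 0 < 1 - δ := sub_pos.2 hδ1
    positivity
  set U := testInclusion g F.totalSpace u with hU
  set v := N.average U with hv
  have hus := u.2.1
  have hum : Measurable u.1 := hus.continuous.measurable
  have huL : MemLp u.1 2 ((riemannianMeasure g).restrict F.totalSpace) := testFunctions_memLp u.2
  have hUae : U =ᵐ[(riemannianMeasure g).restrict F.totalSpace] u.1 := huL.coeFn_toLp
  have hvm : Measurable v := (Lp.stronglyMeasurable v).measurable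
  have hgc := continuous_gradInner g hus hus
  have hgm : Measurable fun x => ENNReal.ofReal (gradInner g u.1 u.1 x).re :=
    (Complex.measurable_re.comp hgc.measurable).ennreal_ofReal
  have hdev : Measurable fun x => ‖u.1 x - N.liftFun v x‖ₑ ^ 2 :=
    (hum.sub (N.measurable_liftFun hvm)).enorm.pow_const 2
  have hDae : N.fluctuation U
      =ᵐ[(riemannianMeasure g).restrict F.totalSpace] fun x => u.1 x - N.liftFun v x := by
    have h1 : N.fluctuation U = U - N.lift v := rfl
    rw [h1]
    have h2 : N.lift v =ᵐ[(riemannianMeasure g).restrict F.totalSpace] N.liftFun v :=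
      (N.memLp_liftFun v).coeFn_toLp
    filter_upwards [Lp.coeFn_sub U (N.lift v), hUae, h2] with x hx hx1 hx2
    rw [hx, Pi.sub_apply, hx1, hx2]
  have hvae : v =ᵐ[(riemannianMeasure gB).restrict B₀] N.averageFun U :=
    (N.memLp_averageFun U).coeFn_toLp
  -- The disintegration writes both integrals over the base with the same weight `A(b)`, so the
  -- inequality may be checked fiber by fiber, whatever the size of `A`.
  have hmain : ‖N.fluctuation U‖ₑ ^ 2 ≤
      ENNReal.ofReal κ * ∫⁻ x in F.totalSpace, ENNReal.ofReal (gradInner g u.1 u.1 x).re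
        ∂riemannianMeasure g := by
    rw [enorm_sq_eq_lintegral, lintegral_congr_ae (hDae.mono fun x hx => by simp only [hx]; rfl),
      N.lintegral_eq' hdev, N.lintegral_eq' hgm, ← lintegral_const_mul' _ _ ENNReal.ofReal_ne_top]
    refine lintegral_mono_ae ?_
    filter_upwards [hvae, N.ae_fiberProb hUae, hδ.ae_fiberHaar, N.ae_memLp_fiber hum huL,
      ae_restrict_mem B₀.isOpen.measurableSet] with b hvb hUb hδb hub hb
    have hA := N.area_pos b hb
    -- The powers `A^{-1/2}` and `A^{1/2}` cancel: on each fiber `I P u` is the mean of `u` for `ρ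
    -- ϑ_b`.
    have hlift : ∀ᵐ x ∂N.fiberProb b, N.liftFun v x = ∫ y, u.1 y ∂N.fiberProb b := by
      filter_upwards [N.ae_proj_eq hb] with x hx
      rw [liftFun, hx, hvb, N.averageFun_eq _ hb, integral_congr_ae hUb, ← mul_assoc,
        ← Complex.ofReal_mul, ← Real.rpow_add hA]
      norm_num
    rw [lintegral_congr_ae (g := fun x => ‖u.1 x - ∫ y, u.1 y ∂N.fiberProb b‖ₑ ^ 2)
      (hlift.mono fun x hx => by simp only [hx]), mul_left_comm]
    gcongr
    exact N.lintegral_fiberProb_sub_mean_le hsf hε hδ0 hδ1 hus hb hδb hl (hlb b hb) hub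
  have hint := (testFunctions_integrable_gradInner g u.2 u.2).re
  rw [norm_sq_sub_norm_testInclusion_sq, ← ENNReal.ofReal_le_ofReal_iff (mul_nonneg hκ0
    (integral_nonneg fun x => gradInner_self_nonneg g u.1 x)), ENNReal.ofReal_mul hκ0,
    ENNReal.ofReal_pow (norm_nonneg _), ofReal_norm]
  refine hmain.trans_eq ?_
  congr 1
  exact (ofReal_integral_eq_lintegral_ofReal hint
    (ae_of_all _ fun x => gradInner_self_nonneg g u.1 x)).symm

/-- The defect of the semigroup property of the compressed heat operators. -/
lemma norm_compressedHeat_comp_sub_le [T1Space B] (N : NormalizedDisintegration F gB g)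
    {ε δ l : ℝ} (hsf : F.SemiFlatControl gB g ε) (hε : 0 < 1 + ε) (hδ0 : 0 < 1 + δ) (hδ1 : δ < 1)
    (hδ : N.DensityControl δ) (hl : 0 < l) (hlb : ∀ b ∈ B₀, l ≤ F.fiberLambdaOne b)
    {τ σ : ℝ} (hτ : 0 < τ) (hσ : 0 < σ) :
    ‖N.compressedHeat τ ∘L N.compressedHeat σ - N.compressedHeat (τ + σ)‖ ≤
      √((1 + δ) * (l⁻¹ * (1 + ε)) * (1 - δ)⁻¹ * (2 * σ)⁻¹) := by
  have hι := norm_testInclusion_le g F.totalSpace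
  have hκ0 : 0 ≤ (1 + δ) * (l⁻¹ * (1 + ε)) * (1 - δ)⁻¹ := by
    have : 0 < 1 - δ := sub_pos.2 hδ1
    positivity
  have hDT : ‖N.fluctuation ∘L dirichletHeat g F.totalSpace σ‖ ≤ _ := norm_comp_formHeat_le hι N.fluctuation hκ0
    (N.norm_fluctuation_sq_le hsf hε hδ0 hδ1 hδ hl hlb) hσ
  have hsemi : dirichletHeat g F.totalSpace (τ + σ) =
      dirichletHeat g F.totalSpace τ ∘L dirichletHeat g F.totalSpace σ :=
    (formHeat_comp _ hτ hσ).symm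
  -- The two terms differ only by the factor `I P` inserted between `T(τ)` and `T(σ)`; the smoothing
  -- at time `σ` is applied directly under `1 - I P`, which is why only `σ` enters the bound.
  have hdefect : N.compressedHeat τ ∘L N.compressedHeat σ - N.compressedHeat (τ + σ) =
      -(N.average ∘L dirichletHeat g F.totalSpace τ ∘L (N.fluctuation ∘L dirichletHeat g F.totalSpace σ) ∘L
        N.lift) := by
    ext1 f
    simp only [compressedHeat, hsemi, fluctuation, sub_apply, neg_apply,
      ContinuousLinearMap.comp_apply, ContinuousLinearMap.id_apply, map_sub, neg_sub]
  rw [hdefect, norm_neg]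
  refine ContinuousLinearMap.opNorm_le_bound _ (Real.sqrt_nonneg _) fun f => ?_
  simp only [ContinuousLinearMap.comp_apply]
  refine (N.average.le_of_opNorm_le N.norm_average_le _).trans ?_
  rw [one_mul]
  refine (ContinuousLinearMap.le_of_opNorm_le _ (norm_formHeat_le hι hτ) _).trans ?_
  rw [one_mul]
  refine ((N.fluctuation ∘L dirichletHeat g F.totalSpace σ).le_of_opNorm_le hDT (N.lift f)).trans ?_
  have := N.lift.le_of_opNorm_le N.norm_lift_le f
  rw [one_mul] at this
  gcongr

end NormalizedDisintegration

end SemiFlat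

/-! ### Uniform constants for small `t`. -/

theorem mainTheorem7
    {B : Type*} [TopologicalSpace B] [T2Space B] [SecondCountableTopology B]
    [ChartedSpace (EucSpace 2) B] [IsManifold (𝓡 2) ∞ B] [MeasurableSpace B] [BorelSpace B]
    (gB : SmoothMetric 2 B) (B₀ : TopologicalSpace.Opens B)
    (_hB₀ : IsCompact (closure (B₀ : Set B)))
    {t₀ : ℝ} (_ht₀ : 0 < t₀) {X : Ioc (0 : ℝ) t₀ → Type*}
    [∀ t, TopologicalSpace (X t)] [∀ t, T2Space (X t)] [∀ t, SecondCountableTopology (X t)]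
    [∀ t, ChartedSpace (EucSpace 4) (X t)] [∀ t, IsManifold (𝓡 4) ∞ (X t)]
    [∀ t, MeasurableSpace (X t)] [∀ t, BorelSpace (X t)]
    (g : ∀ t, SmoothMetric 4 (X t)) (F : ∀ t, FlatTorusFibration B₀ (X t))
    (N : ∀ t, NormalizedDisintegration (F t) gB (g t))
    (s ε : Ioc (0 : ℝ) t₀ → ℝ) (_hs : ∀ t, 0 < s t)
    (_hs₀ : Tendsto s (comap Subtype.val (𝓝[>] (0 : ℝ))) (𝓝 0))
    (_hε₀ : Tendsto ε (comap Subtype.val (𝓝[>] (0 : ℝ))) (𝓝 0))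
    (_hsf : ∀ t, (F t).SemiFlatControl gB (g t) (ε t))
    (K : ℝ) (_hρ : ∀ t, (N t).DensityControl (K * ε t))
    (c : ℝ) (_hc : 0 < c)
    (_hgap : ∀ t, ∀ b ∈ B₀, c * (s t ^ 2)⁻¹ ≤ (F t).fiberLambdaOne b) :
    (∃ C > 0, ∃ t₁ > 0, ∀ t : Ioc (0 : ℝ) t₀, (t : ℝ) ≤ t₁ → ∀ τ > 0, ∀ σ > 0,
      ‖(N t).compressedHeat τ ∘L (N t).compressedHeat σ - (N t).compressedHeat (τ + σ)‖ ≤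
        C * (s t / √σ)) ∧
    ∀ τ > 0, Tendsto
      (fun t => ‖(N t).compressedHeat τ ∘L (N t).compressedHeat τ - (N t).compressedHeat (2 * τ)‖)
      (comap Subtype.val (𝓝[>] (0 : ℝ))) (𝓝 0) := by
  -- The threshold `1/2` bounds each of `1 + ε`, `1 + Kε` and `(1 - Kε)⁻¹` by `2`.
  have hsmall : ∀ᶠ t : Ioc (0 : ℝ) t₀ in comap Subtype.val (𝓝[>] (0 : ℝ)),
      |ε t| < 1 / 2 ∧ |K * ε t| < 1 / 2 := by
    have h1 : Tendsto (fun t => |ε t|) (comap Subtype.val (𝓝[>] (0 : ℝ))) (𝓝 0) := by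
      simpa using _hε₀.abs
    have h2 : Tendsto (fun t => |K * ε t|) (comap Subtype.val (𝓝[>] (0 : ℝ))) (𝓝 0) := by
      simpa using (_hε₀.const_mul K).abs
    exact (h1.eventually_lt_const (by norm_num)).and (h2.eventually_lt_const (by norm_num))
  have hbound : ∀ t : Ioc (0 : ℝ) t₀, |ε t| < 1 / 2 ∧ |K * ε t| < 1 / 2 → ∀ τ > 0, ∀ σ > 0,
      ‖(N t).compressedHeat τ ∘L (N t).compressedHeat σ - (N t).compressedHeat (τ + σ)‖ ≤
        2 / √c * (s t / √σ) := by
    rintro t ⟨h1, h2⟩ τ hτ σ hσ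
    have hs := _hs t
    rw [abs_lt] at h1 h2
    have hl : 0 < c * (s t ^ 2)⁻¹ := by positivity
    refine ((N t).norm_compressedHeat_comp_sub_le (_hsf t) (by linarith) (by linarith)
      (by linarith) (_hρ t) hl (_hgap t) hτ hσ).trans ?_
    -- The factor `4` is `2 · 2 · 2` from the three errors times the `1/2` of the smoothing
    -- estimate, and `1/l = s² / c`; its square root gives `C = 2 / √c`.
    have hC : 2 / √c * (s t / √σ) = √(4 * ((c * (s t ^ 2)⁻¹)⁻¹ * σ⁻¹)) := by
      symm
      rw [Real.sqrt_eq_iff_mul_self_eq (by positivity) (by positivity)]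
      have hc' := Real.mul_self_sqrt _hc.le
      have hσ' := Real.mul_self_sqrt hσ.le
      rw [mul_inv, inv_inv, div_mul_div_comm, div_mul_div_comm,
        show √c * √σ * (√c * √σ) = (√c * √c) * (√σ * √σ) by ring, hc', hσ']
      field_simp
      norm_num
    rw [hC]
    refine Real.sqrt_le_sqrt ?_
    have h3 : (1 - K * ε t)⁻¹ ≤ 2 := by
      rw [inv_le_comm₀ (by linarith) two_pos]
      linarith
    have h4 : 0 ≤ (1 - K * ε t)⁻¹ := inv_nonneg.2 (by linarith)
    set m := (c * (s t ^ 2)⁻¹)⁻¹ with hm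
    have hm0 : 0 < m := inv_pos.2 hl
    have h5 : 0 ≤ m * (1 + ε t) := mul_nonneg hm0.le (by linarith)
    calc (1 + K * ε t) * (m * (1 + ε t)) * (1 - K * ε t)⁻¹ * (2 * σ)⁻¹
        ≤ 2 * (m * 2) * 2 * (2 * σ)⁻¹ := by
          gcongr <;> linarith
      _ = 4 * (m * σ⁻¹) := by
          rw [mul_inv]
          ring
  refine ⟨⟨2 / √c, by positivity, ?_⟩, fun τ hτ => ?_⟩
  · obtain ⟨S, hS, hSsub⟩ := mem_comap.1 hsmall
    -- A right neighborhood of `0` contains an interval closed at its right end `r`, so `t₁ = r`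
    -- works with the non-strict condition on `t`.
    obtain ⟨r, hr, hrS⟩ := mem_nhdsGT_iff_exists_Ioc_subset.1 hS
    exact ⟨r, hr, fun t ht => hbound t (hSsub (hrS ⟨t.2.1, ht⟩))⟩
  · have hlim : Tendsto (fun t => 2 / √c * (s t / √τ)) (comap Subtype.val (𝓝[>] (0 : ℝ))) (𝓝 0) := by
      simpa using (_hs₀.div_const √τ).const_mul (2 / √c)
    refine squeeze_zero' (Eventually.of_forall fun t => norm_nonneg _) ?_ hlim
    filter_upwards [hsmall] with t ht
    rw [two_mul]
    exact hbound t ht τ hτ τ hτ
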